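/- For complex numbers $a,q$ and an integer $m\ge 0$ put $(a;q)_m=\prod_{j=0}^{m-1}(1-aq^j)$, and for $|q|<1$ put $(a;q)_\infty=\prod_{j=0}^{\infty}(1-aq^j)$ and $(a,b,c;q)_\infty=(a;q)_\infty(b;q)_\infty(c;q)_\infty$. Then for every complex $q$ with $|q|<1$ the following three double series converge absolutely and $$\sum_{n,r\ge 0}\frac{(-1)^n q^{\frac52 n^2+4nr+2r^2+\frac32 n+2r}\,(q;q)_{2n+3r+1}(q;q)_{n+2r+1}(q;q)_{n+r}}{(q^3;q^3)_{n+r}(q;q)_n(q;q)_r(q^3;q^3)_{n+2r+1}(q;q)_{2n+2r+1}}=\frac{(q,q^6,q^7;q^7)_\infty}{(q^3;q^3)_\infty},$$ $$1-\sum_{n,r\ge 0}\frac{(-1)^n q^{\frac52 n^2+4nr+2r^2+\frac92 n+5r+2}\,(q;q)_{2n+3r+1}(q;q)_{n+r+1}(q;q)_{n+2r+1}(1+q^{n+r+1})}{(q^3;q^3)_{n+r+1}(q;q)_n(q;q)_r(q^3;q^3)_{n+2r+1}(q;q)_{2n+2r+2}}=\frac{(q^2,q^5,q^7;q^7)_\infty}{(q^3;q^3)_\infty},$$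 $$\sum_{n,r\ge 0}\frac{(-1)^n q^{\frac52 n^2+4nr+2r^2-\frac12 n}\,(q;q)_{2n+3r}(q;q)_{n+2r}(q;q)_{n+r}}{(q;q)_{2n+2r}(q;q)_n(q;q)_r(q^3;q^3)_{n+2r}(q^3;q^3)_{n+r}}=\frac{(q^3,q^4,q^7;q^7)_\infty}{(q^3;q^3)_\infty}.$$ -/

import Mathlib

/-- The finite `q`-shifted factorial `(a; q)_m = ∏_{j=0}^{m-1} (1 - a q^j)`. -/
noncomputable def qPoch (a q : ℂ) (m : ℕ) : ℂ :=
  ∏ j ∈ Finset.range m, (1 - a * q ^ j)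

/-- The infinite `q`-shifted factorial `(a; q)_∞ = ∏_{j=0}^∞ (1 - a q^j)`, for `|q| < 1`. -/
noncomputable def qPochInf (a q : ℂ) : ℂ :=
  ∏' j : ℕ, (1 - a * q ^ j)

/-- The infinite product defining `(a; q)_∞` converges for `|q| < 1`,
so its value is the genuine one. -/
theorem multipliable_qPochInf (a : ℂ) {q : ℂ} (hq : ‖q‖ < 1) :
    Multipliable fun j : ℕ => 1 - a * q ^ j := by
  have h : Summable fun j : ℕ => ‖-(a * q ^ j)‖ := by
    simp only [norm_neg, norm_mul, norm_pow]
    exact (summable_geometric_of_lt_one (norm_nonneg q) hq).mul_left _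
  simpa [sub_eq_add_neg] using multipliable_one_add_of_summable h

/-- The abbreviation `(a, b, c; q)_∞ = (a; q)_∞ (b; q)_∞ (c; q)_∞`. -/
noncomputable def qPochInf₃ (a b c q : ℂ) : ℂ :=
  qPochInf a q * qPochInf b q * qPochInf c q

/-- The summand of the first double sum, with exponent `(5/2)n² + 4nr + 2r² + (3/2)n + 2r`
(the division by 2 is exact). -/
noncomputable def summand₁ (q : ℂ) (n r : ℕ) : ℂ :=
  ((-1) ^ n * q ^ ((5 * n ^ 2 + 3 * n) / 2 + 4 * n * r + 2 * r ^ 2 + 2 * r) *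
      qPoch q q (2 * n + 3 * r + 1) * qPoch q q (n + 2 * r + 1) * qPoch q q (n + r)) /
    (qPoch (q ^ 3) (q ^ 3) (n + r) * qPoch q q n * qPoch q q r *
      qPoch (q ^ 3) (q ^ 3) (n + 2 * r + 1) * qPoch q q (2 * n + 2 * r + 1))

/-- The summand of the second double sum, with exponent
`(5/2)n² + 4nr + 2r² + (9/2)n + 5r + 2` (the division by 2 is exact). -/
noncomputable def summand₂ (q : ℂ) (n r : ℕ) : ℂ :=
  ((-1) ^ n * q ^ ((5 * n ^ 2 + 9 * n) / 2 + 4 * n * r + 2 * r ^ 2 + 5 * r + 2) *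
      qPoch q q (2 * n + 3 * r + 1) * qPoch q q (n + r + 1) * qPoch q q (n + 2 * r + 1) *
      (1 + q ^ (n + r + 1))) /
    (qPoch (q ^ 3) (q ^ 3) (n + r + 1) * qPoch q q n * qPoch q q r *
      qPoch (q ^ 3) (q ^ 3) (n + 2 * r + 1) * qPoch q q (2 * n + 2 * r + 2))

/-- The summand of the third double sum, with exponent `(5/2)n² + 4nr + 2r² - (1/2)n`
(the subtraction never truncates and the division by 2 is exact). -/
noncomputable def summand₃ (q : ℂ) (n r : ℕ) : ℂ :=
  ((-1) ^ n * q ^ ((5 * n ^ 2 - n) / 2 + 4 * n * r + 2 * r ^ 2) *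
      qPoch q q (2 * n + 3 * r) * qPoch q q (n + 2 * r) * qPoch q q (n + r)) /
    (qPoch q q (2 * n + 2 * r) * qPoch q q n * qPoch q q r *
      qPoch (q ^ 3) (q ^ 3) (n + 2 * r) * qPoch (q ^ 3) (q ^ 3) (n + r))

/-! Put N = n + r, p = q³, with d = 1 for the first series and d = 0 for the third. The quotient of
factorials in each summand is the closed form of a finite bilateral sum over j with kernel 1 /
((q)_{r-j} (q)_{r+d+j}) (`bilateralSum_eq`). For fixed N the sum over r then touches only this
kernel, and inverse q-Vandermonde evaluates it. The ratios (q)_m / (p; p)_m in the weights turn the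
remaining factorials into base p, leaving p^{N²+dN} ∑_j (-1)^j q^{j(j-1)/2} / ((p)_{N-j}
(p)_{N+d+j}) (`sum_qTri_mul_bilateralSum`, `sum_antidiagonal_bilateralSum`).

Summing over N by a limiting case of the Bailey lemma (`tsum_pow_mul_tsum_qInv`) replaces the kernel
by p^{j²+dj} / (p; p)_∞. Since j(j-1)/2 + 3j² = 7j(j-1)/2 + 3j, what is left is a theta series in
base q⁷, which the Jacobi triple product factors.

The second series is a d = 0 sum with the extra weight q^{2j}: its term N = 0 is the isolated 1, and
its term N = M + 1 reduces to the d = 1 sum at level M (`tsum_qTri_mul_zpow_two_mul_eq`). Integer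
powers of q are used throughout, so q = 0 is checked directly. -/

/-! ### q-shifted factorials and their reciprocals on the integers -/

theorem one_sub_pow_succ_ne_zero {q : ℂ} (hq : ‖q‖ < 1) (n : ℕ) : 1 - q ^ (n + 1) ≠ 0 := by
  intro h
  have h1 : ‖q ^ (n + 1)‖ < 1 := by
    rw [norm_pow]; exact pow_lt_one₀ (norm_nonneg q) hq (Nat.succ_ne_zero n)
  rw [← sub_eq_zero.mp h, norm_one] at h1
  exact lt_irrefl _ h1

theorem norm_pow_lt_one {q : ℂ} (hq : ‖q‖ < 1) {k : ℕ} (hk : k ≠ 0) : ‖q ^ k‖ < 1 := by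
  rw [norm_pow]; exact pow_lt_one₀ (norm_nonneg q) hq hk

theorem qPoch_zero (a q : ℂ) : qPoch a q 0 = 1 := by simp [qPoch]

theorem qPoch_succ (a q : ℂ) (n : ℕ) : qPoch a q (n + 1) = qPoch a q n * (1 - a * q ^ n) :=
  Finset.prod_range_succ _ _

theorem qPoch_self_succ (q : ℂ) (n : ℕ) :
    qPoch q q (n + 1) = qPoch q q n * (1 - q ^ (n + 1)) := by
  rw [qPoch_succ, pow_succ' q n]

theorem qPoch_self_ne_zero {q : ℂ} (hq : ‖q‖ < 1) (n : ℕ) : qPoch q q n ≠ 0 := by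
  refine Finset.prod_ne_zero_iff.mpr fun j _ => ?_
  rw [← pow_succ']
  exact one_sub_pow_succ_ne_zero hq j

theorem tendsto_qPoch (a : ℂ) {q : ℂ} (hq : ‖q‖ < 1) :
    Filter.Tendsto (qPoch a q) Filter.atTop (nhds (qPochInf a q)) :=
  (multipliable_qPochInf a hq).hasProd.tendsto_prod_nat

theorem qPochInf_self_ne_zero {q : ℂ} (hq : ‖q‖ < 1) : qPochInf q q ≠ 0 := by
  have := tprod_one_add_ne_zero_of_summable (f := fun n : ℕ => -(q * q ^ n)) ?_ ?_
  · simpa [qPochInf, sub_eq_add_neg] using this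
  · intro n
    have := one_sub_pow_succ_ne_zero hq n
    rwa [pow_succ', sub_eq_add_neg] at this
  · simp only [norm_neg, norm_mul, norm_pow]
    exact (summable_geometric_of_lt_one (norm_nonneg q) hq).mul_left _

/-- The reciprocal `1 / (q; q)_m`, extended by zero to negative integers `m`. -/
noncomputable def qInv (q : ℂ) (m : ℤ) : ℂ :=
  if 0 ≤ m then (qPoch q q m.toNat)⁻¹ else 0

theorem qInv_natCast (q : ℂ) (n : ℕ) : qInv q n = (qPoch q q n)⁻¹ := by simp [qInv]

theorem qInv_zero (q : ℂ) : qInv q 0 = 1 := by simp [qInv, qPoch]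

theorem qInv_of_neg (q : ℂ) {m : ℤ} (hm : m < 0) : qInv q m = 0 := by
  simp [qInv, not_le.mpr hm]

/-- Extension by zero makes the recurrence valid for every integer, including m = 0 where 1 - q^m
vanishes. Bilateral sums can therefore be shifted without boundary terms. -/
theorem one_sub_zpow_mul_qInv {q : ℂ} (hq : ‖q‖ < 1) (m : ℤ) :
    (1 - q ^ m) * qInv q m = qInv q (m - 1) := by
  rcases lt_trichotomy m 0 with h | rfl | h
  · rw [qInv_of_neg q h, qInv_of_neg q (by omega), mul_zero]
  · rw [qInv_of_neg q (by norm_num : (0 : ℤ) - 1 < 0)]; simp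
  · obtain ⟨n, rfl⟩ : ∃ n : ℕ, m = ((n + 1 : ℕ) : ℤ) := ⟨m.toNat - 1, by omega⟩
    rw [show (((n + 1 : ℕ) : ℤ) - 1) = (n : ℤ) by push_cast; ring, qInv_natCast, qInv_natCast,
      zpow_natCast, qPoch_self_succ]
    have := one_sub_pow_succ_ne_zero hq n
    have := qPoch_self_ne_zero hq n
    field_simp

theorem tendsto_qInv {q : ℂ} (hq : ‖q‖ < 1) :
    Filter.Tendsto (fun n : ℕ => qInv q n) Filter.atTop (nhds (qPochInf q q)⁻¹) := by
  simp only [qInv_natCast]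
  exact (tendsto_qPoch q hq).inv₀ (qPochInf_self_ne_zero hq)

theorem tendsto_qInv_add {q : ℂ} (hq : ‖q‖ < 1) (k : ℤ) :
    Filter.Tendsto (fun n : ℕ => qInv q (n + k)) Filter.atTop (nhds (qPochInf q q)⁻¹) := by
  have h : Filter.Tendsto (fun n : ℕ => ((n : ℤ) + k).toNat) Filter.atTop Filter.atTop := by
    refine Filter.tendsto_atTop.mpr fun b => ?_
    filter_upwards [Filter.eventually_ge_atTop (b + k.natAbs)] with n hn
    omega
  refine ((tendsto_qInv hq).comp h).congr' ?_
  filter_upwards [Filter.eventually_ge_atTop k.natAbs] with n hn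
  simp only [Function.comp_apply]
  congr 1
  omega

theorem exists_norm_qPoch_le {q : ℂ} (hq : ‖q‖ < 1) (a : ℂ) :
    ∃ C : ℝ, 0 < C ∧ ∀ n, ‖qPoch a q n‖ ≤ C := by
  obtain ⟨C, hC0, hC⟩ := (Metric.isBounded_range_of_tendsto _ (tendsto_qPoch a hq)).exists_pos_norm_le
  exact ⟨C, hC0, fun n => hC _ ⟨n, rfl⟩⟩

theorem exists_norm_qInv_le {q : ℂ} (hq : ‖q‖ < 1) :
    ∃ C : ℝ, 0 < C ∧ ∀ m, ‖qInv q m‖ ≤ C := by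
  obtain ⟨C, hC0, hC⟩ := (Metric.isBounded_range_of_tendsto _ (tendsto_qInv hq)).exists_pos_norm_le
  refine ⟨C, hC0, fun m => ?_⟩
  rcases lt_or_ge m 0 with h | h
  · rw [qInv_of_neg q h, norm_zero]; exact hC0.le
  · lift m to ℕ using h
    exact hC _ ⟨m, rfl⟩

theorem summable_mul_qInv_mul_qInv (q : ℂ) (F : ℤ → ℂ) (a b : ℤ) :
    Summable fun j : ℤ => F j * (qInv q (a - j) * qInv q (b + j)) := by
  refine summable_of_ne_finset_zero (s := Finset.Icc (-b) a) fun j hj => ?_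
  rw [Finset.mem_Icc, not_and_or, not_le, not_le] at hj
  rcases hj with h | h
  · rw [qInv_of_neg q (by omega : b + j < 0)]; simp
  · rw [qInv_of_neg q (by omega : a - j < 0)]; simp

/-! ### Triangular weights and bilateral sums -/

/-- The weight `(-1)^j q^{j(j-1)/2}` for an integer `j`. -/
noncomputable def qTri (q : ℂ) (j : ℤ) : ℂ := (-1) ^ j * q ^ (j * (j - 1) / 2)

theorem qTri_zero (q : ℂ) : qTri q 0 = 1 := by simp [qTri]

theorem qTri_add_one {q : ℂ} (h0 : q ≠ 0) (j : ℤ) : qTri q (j + 1) = -q ^ j * qTri q j := by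
  have : (j + 1) * (j + 1 - 1) / 2 = j + j * (j - 1) / 2 := by
    rw [show (j + 1) * (j + 1 - 1) = j * (j - 1) + j * 2 by ring,
      Int.add_mul_ediv_right _ _ two_ne_zero, add_comm]
  rw [qTri, qTri, this, zpow_add₀ h0, zpow_add₀ (by norm_num), zpow_one]
  ring

theorem qTri_neg {q : ℂ} (h0 : q ≠ 0) (j : ℤ) : qTri q (-j) = q ^ j * qTri q j := by
  have : -j * (-j - 1) / 2 = j + j * (j - 1) / 2 := by
    rw [show -j * (-j - 1) = j * (j - 1) + j * 2 by ring,
      Int.add_mul_ediv_right _ _ two_ne_zero, add_comm]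
  rw [qTri, qTri, this, zpow_add₀ h0, zpow_neg, ← inv_zpow, inv_neg, inv_one]
  ring

theorem qTri_neg_sub_one {q : ℂ} (h0 : q ≠ 0) (j : ℤ) :
    qTri q (-1 - j) = -(q * q ^ j * q ^ j) * qTri q j := by
  rw [show -1 - j = -(j + 1) by ring, qTri_neg h0, qTri_add_one h0, zpow_add_one₀ h0]
  ring

theorem mul_sub_one_ediv_two_nonneg (j : ℤ) : 0 ≤ j * (j - 1) / 2 := by
  apply Int.ediv_nonneg _ (by norm_num)
  rcases le_or_gt j 0 with h | h
  · nlinarith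
  · nlinarith

theorem two_mul_mul_sub_one_ediv_two (j : ℤ) : 2 * (j * (j - 1) / 2) = j * (j - 1) :=
  Int.mul_ediv_cancel' (Int.even_mul_pred_self j).two_dvd

theorem norm_zpow_le_one {q : ℂ} (hq : ‖q‖ < 1) {k : ℤ} (hk : 0 ≤ k) : ‖q ^ k‖ ≤ 1 := by
  lift k to ℕ using hk
  rw [zpow_natCast, norm_pow]
  exact pow_le_one₀ (norm_nonneg q) hq.le

theorem norm_qTri_le_one {q : ℂ} (hq : ‖q‖ < 1) (j : ℤ) : ‖qTri q j‖ ≤ 1 := by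
  rw [qTri, norm_mul, norm_zpow, norm_neg, norm_one, one_zpow, one_mul]
  exact norm_zpow_le_one hq (mul_sub_one_ediv_two_nonneg j)

/-- The base change `q ↦ q^7` for the weights `qTri`. -/
theorem qTri_pow_seven {q : ℂ} (h0 : q ≠ 0) (j : ℤ) :
    qTri (q ^ 7) j = qTri q j * (q ^ 3) ^ (j * j) * ((q ^ 3) ^ j)⁻¹ := by
  have h := two_mul_mul_sub_one_ediv_two j
  rw [qTri, qTri, mul_assoc, mul_assoc, ← zpow_neg]
  congr 1
  simp only [← zpow_natCast, ← zpow_mul]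
  rw [← zpow_add₀ h0, ← zpow_add₀ h0]
  congr 1
  push_cast
  linear_combination 3 * h

theorem tsum_int_shift (f : ℤ → ℂ) (k : ℤ) : ∑' j, f (j + k) = ∑' j, f j :=
  (Equiv.addRight k).tsum_eq f

theorem tsum_int_reflect (f : ℤ → ℂ) (k : ℤ) : ∑' j, f (k - j) = ∑' j, f j :=
  (Equiv.subLeft k).tsum_eq f

theorem tsum_int_sub_shift {f : ℤ → ℂ} (hf : Summable f) : ∑' j, (f j - f (j + 1)) = 0 := by
  have : Summable fun j => f (j + 1) := (Equiv.addRight (1 : ℤ)).summable_iff.mpr hf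
  rw [hf.tsum_sub this, tsum_int_shift, sub_self]

/-! ### Jacobi triple product -/

/-- A truncation of the theta series `∑ (-1)^j p^{j(j-1)/2} x^j`. -/
noncomputable def truncTheta (p x : ℂ) (a b : ℤ) : ℂ :=
  ∑' j : ℤ, qTri p j * x ^ j * (qInv p (a - j) * qInv p (b + j))

theorem truncTheta_add_one_right {p x : ℂ} (h0 : p ≠ 0) (hp : ‖p‖ < 1) (hx : x ≠ 0) (a b : ℤ) :
    (1 - p ^ (a + b + 1)) * truncTheta p x a (b + 1) =
      (1 - p ^ (b + 1) / x) * truncTheta p x a b := by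
  set F : ℤ → ℂ := fun j => qTri p j * x ^ j * (qInv p (a - j) * qInv p (b + j)) with hF
  have hFs : Summable F := summable_mul_qInv_mul_qInv p _ a b
  have hFs' : Summable fun j => F (j + 1) := (Equiv.addRight (1 : ℤ)).summable_iff.mpr hFs
  -- With u = p^{a-j} and v = p^{b+1+j}, the factor is 1 - uv = (1 - v) + v(1 - u); each bracket
  -- lowers one reciprocal, and the second piece is a multiple of the shifted term.
  have hterm : ∀ j, (1 - p ^ (a + b + 1)) *
      (qTri p j * x ^ j * (qInv p (a - j) * qInv p (b + 1 + j))) =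
      F j + -(p ^ (b + 1) / x) * F (j + 1) := by
    intro j
    have h1 := one_sub_zpow_mul_qInv hp (b + 1 + j)
    have h2 := one_sub_zpow_mul_qInv hp (a - j)
    rw [show b + 1 + j - 1 = b + j by ring] at h1
    rw [show a - j - 1 = a - (j + 1) by ring] at h2
    have h3 : p ^ (a + b + 1) = p ^ (a - j) * p ^ (b + 1 + j) := by
      rw [← zpow_add₀ h0]; congr 1; ring
    have h4 : p ^ (b + 1 + j) = p ^ (b + 1) * p ^ j := zpow_add₀ h0 _ _
    simp only [hF]
    rw [← h1, ← h2, qTri_add_one h0, zpow_add_one₀ hx, h3, h4,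
      show b + (j + 1) = b + 1 + j by ring]
    field_simp
    ring
  rw [truncTheta, ← tsum_mul_left, tsum_congr hterm, hFs.tsum_add (hFs'.mul_left _),
    tsum_mul_left, tsum_int_shift, truncTheta]
  ring

theorem truncTheta_add_one_left {p x : ℂ} (h0 : p ≠ 0) (hp : ‖p‖ < 1) (hx : x ≠ 0) (a b : ℤ) :
    (1 - p ^ (a + b + 1)) * truncTheta p x (a + 1) b =
      (1 - x * p ^ a) * truncTheta p x a b := by
  set F : ℤ → ℂ := fun j => qTri p j * x ^ j * (qInv p (a - j) * qInv p (b + j)) with hF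
  set G : ℤ → ℂ := fun j => qTri p j * x ^ j * (qInv p (a + 1 - j) * qInv p (b + j)) with hG
  have hFs : Summable F := summable_mul_qInv_mul_qInv p _ a b
  have hFs' : Summable fun j => F (j + 1) := (Equiv.addRight (1 : ℤ)).summable_iff.mpr hFs
  -- The mirror splitting 1 - uv = (1 - u) + u(1 - v), with u = p^{a-j} and v = p^{b+j+1}.
  have hterm : ∀ j, (1 - p ^ (a + b + 1)) * G (j + 1) = F (j + 1) + -(x * p ^ a) * F j := by
    intro j
    have h1 := one_sub_zpow_mul_qInv hp (b + (j + 1))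
    have h2 := one_sub_zpow_mul_qInv hp (a - j)
    rw [show b + (j + 1) - 1 = b + j by ring] at h1
    rw [show a - j - 1 = a - (j + 1) by ring] at h2
    have h3 : p ^ (a + b + 1) = p ^ (a - j) * p ^ (b + (j + 1)) := by
      rw [← zpow_add₀ h0]; congr 1; ring
    have h4 : p ^ (a - j) = p ^ a / p ^ j := zpow_sub₀ h0 _ _
    have h5 : p ^ j ≠ 0 := zpow_ne_zero _ h0
    simp only [hF, hG]
    rw [← h1, ← h2, qTri_add_one h0, zpow_add_one₀ hx, h3, h4,
      show a + 1 - (j + 1) = a - j by ring]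
    field_simp
    ring
  have hGt : truncTheta p x (a + 1) b = ∑' j, G (j + 1) := (tsum_int_shift G 1).symm
  rw [hGt, ← tsum_mul_left, tsum_congr hterm, hFs'.tsum_add (hFs.mul_left _),
    tsum_mul_left, tsum_int_shift, truncTheta]
  ring

theorem truncTheta_zero (p x : ℂ) : truncTheta p x 0 0 = 1 := by
  rw [truncTheta, tsum_eq_single 0]
  · simp [qTri_zero, qInv_zero]
  · intro j hj
    rcases lt_or_gt_of_ne hj with h | h
    · rw [qInv_of_neg p (by omega : 0 + j < 0)]; simp
    · rw [qInv_of_neg p (by omega : 0 - j < 0)]; simp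

/-- The finite form of the Jacobi triple product. -/
theorem qPoch_mul_truncTheta {p x : ℂ} (h0 : p ≠ 0) (hp : ‖p‖ < 1) (hx : x ≠ 0) (N : ℕ) :
    qPoch p p (2 * N) * truncTheta p x N N = qPoch x p N * qPoch (p / x) p N := by
  induction N with
  | zero => simp [qPoch_zero, truncTheta_zero]
  | succ N ih =>
    have h1 := truncTheta_add_one_right h0 hp hx (N + 1) N
    have h2 := truncTheta_add_one_left h0 hp hx N N
    have e1 : p ^ ((N : ℤ) + N + 1) = p ^ (2 * N + 1) := by
      rw [← zpow_natCast]; congr 1; push_cast; ring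
    have e2 : p ^ ((N : ℤ) + 1 + N + 1) = p ^ (2 * N + 1 + 1) := by
      rw [← zpow_natCast]; congr 1; push_cast; ring
    have e3 : p ^ ((N : ℤ) + 1) = p ^ (N + 1) := by rw [← zpow_natCast]; norm_cast
    rw [e1, zpow_natCast] at h2
    rw [e2, e3] at h1
    rw [show 2 * (N + 1) = 2 * N + 1 + 1 by ring, qPoch_self_succ, qPoch_self_succ, qPoch_succ x,
      qPoch_succ (p / x)]
    push_cast
    calc qPoch p p (2 * N) * (1 - p ^ (2 * N + 1)) * (1 - p ^ (2 * N + 1 + 1)) *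
          truncTheta p x (N + 1) (N + 1)
        = qPoch p p (2 * N) * (1 - p ^ (2 * N + 1)) *
          ((1 - p ^ (2 * N + 1 + 1)) * truncTheta p x (N + 1) (N + 1)) := by ring
      _ = (1 - p ^ (N + 1) / x) * qPoch p p (2 * N) *
          ((1 - p ^ (2 * N + 1)) * truncTheta p x (N + 1) N) := by rw [h1]; ring
      _ = (1 - p ^ (N + 1) / x) * (1 - x * p ^ N) *
          (qPoch p p (2 * N) * truncTheta p x N N) := by rw [h2]; ring
      _ = _ := by rw [ih]; ring

theorem summable_norm_qTri_mul_pow {p y : ℂ} (h0 : p ≠ 0) (hp : ‖p‖ < 1) (hy : y ≠ 0) :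
    Summable fun n : ℕ => ‖qTri p n * y ^ n‖ := by
  have hne : ∀ n : ℕ, qTri p n * y ^ n ≠ 0 := fun n => by
    rw [qTri]
    exact mul_ne_zero (mul_ne_zero (zpow_ne_zero _ (by norm_num)) (zpow_ne_zero _ h0))
      (pow_ne_zero _ hy)
  refine summable_of_ratio_test_tendsto_lt_one (l := 0) zero_lt_one
    (Filter.Eventually.of_forall fun n => norm_ne_zero_iff.mpr (hne n)) ?_
  have hlim : Filter.Tendsto (fun n : ℕ => ‖p‖ ^ n * ‖y‖) Filter.atTop (nhds 0) := by
    simpa using (tendsto_pow_atTop_nhds_zero_of_lt_one (norm_nonneg p) hp).mul_const ‖y‖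
  refine hlim.congr fun n => ?_
  have := norm_ne_zero_iff.mpr (hne n)
  rw [norm_norm, norm_norm, eq_div_iff this, ← norm_pow, ← norm_mul, ← norm_mul]
  push_cast
  rw [qTri_add_one h0, pow_succ, zpow_natCast, ← norm_neg]
  congr 1
  ring

theorem summable_norm_qTri_mul_zpow {p x : ℂ} (h0 : p ≠ 0) (hp : ‖p‖ < 1) (hx : x ≠ 0) :
    Summable fun j : ℤ => ‖qTri p j * x ^ j‖ := by
  refine Summable.of_nat_of_neg ?_ ?_
  · simpa using summable_norm_qTri_mul_pow h0 hp hx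
  · refine (summable_norm_qTri_mul_pow h0 hp (div_ne_zero h0 hx)).congr fun n => ?_
    rw [qTri_neg h0, zpow_neg, zpow_natCast, zpow_natCast, div_pow]
    congr 1
    ring

/-- The Jacobi triple product identity. -/
theorem tsum_qTri_mul_zpow {p x : ℂ} (h0 : p ≠ 0) (hp : ‖p‖ < 1) (hx : x ≠ 0) :
    ∑' j : ℤ, qTri p j * x ^ j = qPochInf x p * qPochInf (p / x) p * qPochInf p p := by
  obtain ⟨C, hC0, hC⟩ := exists_norm_qInv_le hp
  have hP := qPochInf_self_ne_zero hp
  have hlim : Filter.Tendsto (fun N : ℕ => truncTheta p x N N) Filter.atTop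
      (nhds (∑' j : ℤ, qTri p j * x ^ j * ((qPochInf p p)⁻¹ * (qPochInf p p)⁻¹))) := by
    refine tendsto_tsum_of_dominated_convergence
      (bound := fun j => ‖qTri p j * x ^ j‖ * (C * C))
      ((summable_norm_qTri_mul_zpow h0 hp hx).mul_right _) (fun j => ?_)
      (Filter.Eventually.of_forall fun N j => ?_)
    · have h1 := tendsto_qInv_add hp (-j)
      have h2 := tendsto_qInv_add hp j
      simp only [← sub_eq_add_neg] at h1
      exact (h1.mul h2).const_mul _
    · rw [norm_mul, norm_mul (qInv _ _)]
      gcongr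
      · exact hC _
      · exact hC _
  have h2N : Filter.Tendsto (fun N : ℕ => 2 * N) Filter.atTop Filter.atTop :=
    Filter.tendsto_id.const_mul_atTop' two_pos
  have hl := ((tendsto_qPoch p hp).comp h2N).mul hlim
  have hr := (tendsto_qPoch x hp).mul (tendsto_qPoch (p / x) hp)
  have := tendsto_nhds_unique (hl.congr fun N => qPoch_mul_truncTheta h0 hp hx N) hr
  rw [tsum_mul_right] at this
  rw [← this]
  field_simp

/-! ### q-Vandermonde and the limiting Bailey lemma -/

/-- The `q`-Vandermonde sum `∑ p^{k(k+c)} / ((p)_k (p)_{k+c} (p)_{M-k})`. -/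
theorem sum_qVandermonde {p : ℂ} (hp : ‖p‖ < 1) (M c : ℕ) :
    ∑ k ∈ Finset.range (M + 1), p ^ (k * (k + c)) *
      (qInv p k * qInv p (k + c) * qInv p (M - k)) = qInv p M * qInv p (M + c) := by
  induction M generalizing c with
  | zero => simp [qInv_zero]
  | succ M ih =>
    have hM := one_sub_pow_succ_ne_zero hp M
    have hrec : ∀ n : ℕ, (1 - p ^ (n + 1)) * qInv p (n + 1) = qInv p n := fun n => by
      have := one_sub_zpow_mul_qInv hp (n + 1)
      rw [add_sub_cancel_right] at this
      rw [← this]; norm_cast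
    -- Split 1 - p^{M+1} = p^k (1 - p^{M+1-k}) + (1 - p^k). The first part gives ∑ a_k. The second,
    -- shifted by one in k, gives the sum for (M, c+1) minus ∑ a_k, so the a_k cancel.
    set a : ℕ → ℂ := fun k => p ^ (k * (k + c) + k) *
      (qInv p k * qInv p (k + c) * qInv p (M - k)) with ha
    have h1 : (1 - p ^ (M + 1)) * ∑ k ∈ Finset.range (M + 2), p ^ (k * (k + c)) *
        (qInv p k * qInv p (k + c) * qInv p ((M + 1 : ℕ) - k)) =
        ∑ k ∈ Finset.range (M + 2), a k + ∑ k ∈ Finset.range (M + 2), p ^ (k * (k + c)) *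
        ((1 - p ^ k) * qInv p k * qInv p (k + c) * qInv p ((M + 1 : ℕ) - k)) := by
      rw [Finset.mul_sum, ← Finset.sum_add_distrib]
      refine Finset.sum_congr rfl fun k hk => ?_
      obtain ⟨l, hl⟩ : ∃ l, M + 1 = k + l := Nat.exists_eq_add_of_le (by
        have := Finset.mem_range.mp hk; omega)
      have e1 : ((M + 1 : ℕ) : ℤ) - k = l := by omega
      have e2 : (M : ℤ) - k = l - 1 := by omega
      simp only [ha]
      rw [e1, e2, ← one_sub_zpow_mul_qInv hp l, hl, zpow_natCast, pow_add, pow_add]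
      ring
    have h2 : ∑ k ∈ Finset.range (M + 2), a k = ∑ k ∈ Finset.range (M + 1), a k := by
      rw [Finset.sum_range_succ _ (M + 1)]
      simp only [ha]
      rw [qInv_of_neg p (by push_cast; omega : (M : ℤ) - (M + 1 : ℕ) < 0)]
      simp
    have h3 : ∑ k ∈ Finset.range (M + 2), p ^ (k * (k + c)) *
        ((1 - p ^ k) * qInv p k * qInv p (k + c) * qInv p ((M + 1 : ℕ) - k)) =
        ∑ k ∈ Finset.range (M + 1), (p ^ (k * (k + (c + 1))) *
        (qInv p k * qInv p (k + (c + 1 : ℕ)) * qInv p (M - k)) - a k) := by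
      rw [Finset.sum_range_succ']
      simp only [pow_zero, sub_self, zero_mul, mul_zero, add_zero]
      refine Finset.sum_congr rfl fun k _ => ?_
      have e1 := hrec k
      have e2 := hrec (k + c)
      have e3 : ((k + 1 : ℕ) : ℤ) + c = (k + c : ℕ) + 1 := by push_cast; ring
      have e4 : (k : ℤ) + (c + 1 : ℕ) = (k + c : ℕ) + 1 := by push_cast; ring
      have e5 : ((M + 1 : ℕ) : ℤ) - (k + 1 : ℕ) = M - k := by push_cast; ring
      simp only [ha]
      rw [e3, e4, e5, show (k : ℤ) + c = (k + c : ℕ) by push_cast; ring, ← e2]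
      push_cast at e1 ⊢
      rw [e1]
      ring
    rw [Finset.sum_sub_distrib, ih] at h3
    rw [h2, h3] at h1
    have h4 := hrec M
    refine mul_left_cancel₀ hM (h1.trans ?_)
    push_cast at h4 ⊢
    rw [← mul_assoc, h4, show (M : ℤ) + (c + 1) = M + 1 + c by ring]
    ring

theorem summable_norm_pow_mul_add {p : ℂ} (hp : ‖p‖ < 1) (c : ℕ) :
    Summable fun k : ℕ => ‖p ^ (k * (k + c))‖ := by
  refine (summable_geometric_of_lt_one (norm_nonneg p) hp).of_nonneg_of_le
    (fun k => norm_nonneg _) fun k => ?_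
  rw [norm_pow]
  refine pow_le_pow_of_le_one (norm_nonneg p) hp.le ?_
  rcases k.eq_zero_or_pos with rfl | hk
  · simp
  · exact Nat.le_mul_of_pos_right k (by omega)

/-- Let M → ∞ in q-Vandermonde by dominated convergence and cancel one factor 1/(p)_∞. -/
theorem tsum_pow_mul_qInv_mul_qInv_nat {p : ℂ} (hp : ‖p‖ < 1) (c : ℕ) :
    ∑' k : ℕ, p ^ (k * (k + c)) * (qInv p k * qInv p (k + c)) = (qPochInf p p)⁻¹ := by
  obtain ⟨C, hC0, hC⟩ := exists_norm_qInv_le hp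
  have hP := qPochInf_self_ne_zero hp
  have hfin : ∀ M : ℕ, ∑' k : ℕ, p ^ (k * (k + c)) *
      (qInv p k * qInv p (k + c) * qInv p (M - k)) = qInv p M * qInv p (M + c) := fun M => by
    rw [← sum_qVandermonde hp M c, tsum_eq_sum]
    intro k hk
    rw [Finset.mem_range, not_lt] at hk
    rw [qInv_of_neg p (by omega : (M : ℤ) - k < 0)]
    simp
  have hlim : Filter.Tendsto (fun M : ℕ => ∑' k : ℕ, p ^ (k * (k + c)) *
      (qInv p k * qInv p (k + c) * qInv p (M - k))) Filter.atTop
      (nhds (∑' k : ℕ, p ^ (k * (k + c)) *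
        (qInv p k * qInv p (k + c) * (qPochInf p p)⁻¹))) := by
    refine tendsto_tsum_of_dominated_convergence
      (bound := fun k => ‖p ^ (k * (k + c))‖ * (C * C * C))
      ((summable_norm_pow_mul_add hp c).mul_right _) (fun k => ?_)
      (Filter.Eventually.of_forall fun M k => ?_)
    · have h1 := tendsto_qInv_add hp (-k)
      simp only [← sub_eq_add_neg] at h1
      exact (h1.const_mul _).const_mul _
    · rw [norm_mul, norm_mul, norm_mul]
      gcongr <;> exact hC _
  have hr := (tendsto_qInv hp).mul (tendsto_qInv_add hp c)
  have := tendsto_nhds_unique (hlim.congr hfin) hr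
  simp only [← mul_assoc] at this ⊢
  rw [tsum_mul_right] at this
  exact mul_right_cancel₀ (inv_ne_zero hP) this

theorem tsum_pow_mul_qInv_sub_mul_qInv_add_of_nonneg {p : ℂ} (hp : ‖p‖ < 1) (d j : ℕ) :
    ∑' N : ℕ, p ^ (N * N + d * N) * (qInv p (N - j) * qInv p (N + d + j)) =
      p ^ (j * j + d * j) * (qPochInf p p)⁻¹ := by
  rw [← tsum_pow_mul_qInv_mul_qInv_nat hp (2 * j + d), ← tsum_mul_left]
  rw [← (add_left_injective j).tsum_eq]
  · refine tsum_congr fun k => ?_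
    rw [← mul_assoc (p ^ (j * j + d * j)), ← pow_add]
    congr 1
    · congr 1; ring
    · congr 2
      · push_cast; ring
      · push_cast; ring
  · intro N hN
    rw [Set.mem_range]
    refine ⟨N - j, Nat.sub_add_cancel ?_⟩
    by_contra h
    refine hN ?_
    simp only
    rw [qInv_of_neg p (by omega : (N : ℤ) - j < 0)]
    simp

/-- A limiting case of the Bailey lemma: for `d ≤ 1`,
`∑ p^{N² + dN} / ((p)_{N-j} (p)_{N+d+j}) = p^{j² + dj} / (p)_∞`. -/
theorem tsum_pow_mul_qInv_sub_mul_qInv_add {p : ℂ} (hp : ‖p‖ < 1) {d : ℕ}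
    (hd : d ≤ 1) (j : ℤ) :
    ∑' N : ℕ, p ^ (N * N + d * N) * (qInv p (N - j) * qInv p (N + d + j)) =
      p ^ (j * j + d * j) * (qPochInf p p)⁻¹ := by
  rcases le_or_gt 0 j with h | h
  · lift j to ℕ using h
    rw [tsum_pow_mul_qInv_sub_mul_qInv_add_of_nonneg hp]
    norm_cast
  -- The reflection j ↦ -d - j swaps the two reciprocals and fixes j² + dj. It sends negative j to
  -- nonnegative integers exactly because d ≤ 1.
  · obtain ⟨i, hi⟩ : ∃ i : ℕ, -j - d = i := ⟨(-j - d).toNat, by omega⟩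
    have hj : j = -i - d := by omega
    have := tsum_pow_mul_qInv_sub_mul_qInv_add_of_nonneg hp d i
    have e : p ^ (j * j + d * j) = p ^ (i * i + d * i) := by
      rw [← zpow_natCast]; congr 1; subst hj; push_cast; ring
    rw [e, ← this]
    refine tsum_congr fun N => ?_
    subst hj
    rw [mul_comm (qInv p _)]
    congr 3
    · ring
    · ring

/-! ### Closed form of the bilateral sum -/

/-- The ratio `(q; q)_m / (q³; q³)_m`, extended to integers by its value at `0`. -/
noncomputable def qRatio (q : ℂ) (m : ℤ) : ℂ :=
  qPoch q q m.toNat * (qPoch (q ^ 3) (q ^ 3) m.toNat)⁻¹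

theorem qRatio_natCast (q : ℂ) (n : ℕ) :
    qRatio q n = qPoch q q n * (qPoch (q ^ 3) (q ^ 3) n)⁻¹ := by simp [qRatio]

/-- This is the passage from base q to base q³; at negative m both reciprocals vanish, so the
default value of `qRatio` is harmless. -/
theorem qInv_mul_qRatio {q : ℂ} (hq : ‖q‖ < 1) (m : ℤ) :
    qInv q m * qRatio q m = qInv (q ^ 3) m := by
  rcases lt_or_ge m 0 with h | h
  · rw [qInv_of_neg q h, qInv_of_neg _ h, zero_mul]
  · lift m to ℕ using h
    rw [qInv_natCast, qInv_natCast, qRatio_natCast, inv_mul_cancel_left₀ (qPoch_self_ne_zero hq m)]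

theorem qRatio_add_one {q : ℂ} (hq : ‖q‖ < 1) (n : ℕ) :
    (1 + q ^ (n + 1) + (q ^ (n + 1)) ^ 2) * qRatio q (n + 1) = qRatio q n := by
  have h3 := norm_pow_lt_one hq three_ne_zero
  have h1 := one_sub_pow_succ_ne_zero h3 n
  have h2 := qPoch_self_ne_zero h3 n
  have h4 := qRatio_natCast q (n + 1)
  rw [qPoch_self_succ, qPoch_self_succ] at h4
  push_cast at h4
  rw [h4, qRatio_natCast]
  have e : 1 - (q ^ 3) ^ (n + 1) =
      (1 - q ^ (n + 1)) * (1 + q ^ (n + 1) + (q ^ (n + 1)) ^ 2) := by ring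
  rw [e] at h1 ⊢
  obtain ⟨h5, h6⟩ := mul_ne_zero_iff.mp h1
  field_simp

theorem qRatio_sub_one {q : ℂ} (hq : ‖q‖ < 1) {m : ℤ} (hm : 0 < m) :
    (1 + q ^ m + (q ^ m) ^ 2) * qRatio q m = qRatio q (m - 1) := by
  obtain ⟨n, rfl⟩ : ∃ n : ℕ, m = (n : ℤ) + 1 := ⟨m.toNat - 1, by omega⟩
  rw [add_sub_cancel_right, ← qRatio_add_one hq n]
  norm_cast

theorem tsum_eq_zero_of_antisymm {f : ℤ → ℂ} (k : ℤ) (h : ∀ j, f (k - j) = -f j) :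
    ∑' j, f j = 0 := by
  have h1 := tsum_int_reflect f k
  rw [tsum_congr h, tsum_neg] at h1
  exact CharZero.neg_eq_self_iff.mp h1

/-- The weights of the bilateral sum expressing a unit Bailey pair relative to `q^d`. -/
noncomputable def bilateralWeight (q : ℂ) (N d : ℕ) (j : ℤ) : ℂ :=
  qTri q j * q ^ (j * j + d * j) * (qRatio q (N - j) * qRatio q (N + d + j))

theorem bilateralWeight_neg {q : ℂ} (h0 : q ≠ 0) (N : ℕ) (j : ℤ) :
    bilateralWeight q N 0 (-j) = q ^ j * bilateralWeight q N 0 j := by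
  simp only [bilateralWeight]
  rw [qTri_neg h0]
  push_cast
  rw [show -j * -j + 0 * -j = j * j + 0 * j by ring, show (N : ℤ) - -j = N + 0 + j by ring,
    show (N : ℤ) + 0 + -j = N - j by ring]
  ring

theorem bilateralWeight_neg_sub_one {q : ℂ} (h0 : q ≠ 0) (N : ℕ) (j : ℤ) :
    bilateralWeight q N 1 (-1 - j) = -(q * q ^ j * q ^ j) * bilateralWeight q N 1 j := by
  simp only [bilateralWeight]
  rw [qTri_neg_sub_one h0]
  push_cast
  rw [show (-1 - j) * (-1 - j) + 1 * (-1 - j) = j * j + 1 * j by ring,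
    show (N : ℤ) - (-1 - j) = N + 1 + j by ring, show (N : ℤ) + 1 + (-1 - j) = N - j by ring]
  ring

/-- A creative-telescoping certificate: the summand is V_j - V_{j+1} for a finitely supported V. -/
theorem tsum_bilateral_telescope {q : ℂ} (h0 : q ≠ 0) (hq : ‖q‖ < 1) {N r : ℕ} (d : ℕ)
    (hr : r + 1 ≤ N) :
    ∑' j : ℤ, ((q ^ j)⁻¹ * (1 - q ^ (r + 1) * q ^ d * q ^ j) *
        (1 + q ^ N * q ^ d * q ^ j + (q ^ N * q ^ d * q ^ j) ^ 2) +
      q ^ d * (q ^ j) ^ 2 * (1 - q ^ (r + 1) / q ^ j) *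
        (1 + q ^ N / q ^ j + (q ^ N / q ^ j) ^ 2)) * bilateralWeight q N d j *
      (qInv q ((r + 1 : ℕ) - j) * qInv q ((r + 1 : ℕ) + d + j)) = 0 := by
  set V : ℤ → ℂ := fun j => qTri q j * q ^ (j * j + d * j) * (q ^ j)⁻¹ *
    (qRatio q (N - j) * qRatio q (N + d + j - 1)) *
    (qInv q ((r + 1 : ℕ) - j) * qInv q (r + d + j)) with hV
  have hVs : Summable V := by
    have := summable_mul_qInv_mul_qInv q (fun j => qTri q j * q ^ (j * j + d * j) * (q ^ j)⁻¹ *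
      (qRatio q (N - j) * qRatio q (N + d + j - 1))) (r + 1 : ℕ) (r + d)
    exact this
  rw [← tsum_int_sub_shift hVs]
  refine tsum_congr fun j => ?_
  have hj : q ^ j ≠ 0 := zpow_ne_zero _ h0
  have i1 := one_sub_zpow_mul_qInv hq ((r + 1 : ℕ) + d + j)
  have i2 := one_sub_zpow_mul_qInv hq ((r + 1 : ℕ) - j)
  rw [zpow_add₀ h0, zpow_add₀ h0, zpow_natCast, zpow_natCast,
    show ((r + 1 : ℕ) : ℤ) + d + j - 1 = r + d + j by push_cast; ring] at i1
  rw [zpow_sub₀ h0, zpow_natCast,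
    show ((r + 1 : ℕ) : ℤ) - j - 1 = (r + 1 : ℕ) - (j + 1) by ring] at i2
  -- The recurrence for `qRatio` is available only at positive arguments. Where the reciprocal is
  -- nonzero, r + 1 ≤ N guarantees positivity; elsewhere both sides vanish.
  have hfst : (1 + q ^ N * q ^ d * q ^ j + (q ^ N * q ^ d * q ^ j) ^ 2) *
      qRatio q (N + d + j) * qInv q (r + d + j) =
      qRatio q (N + d + j - 1) * qInv q (r + d + j) := by
    rcases lt_or_ge ((r : ℤ) + d + j) 0 with h | h
    · rw [qInv_of_neg q h]; simp
    · rw [← qRatio_sub_one hq (by omega : (0 : ℤ) < N + d + j), zpow_add₀ h0, zpow_add₀ h0,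
        zpow_natCast, zpow_natCast]
  have hsnd : (1 + q ^ N / q ^ j + (q ^ N / q ^ j) ^ 2) *
      qRatio q (N - j) * qInv q ((r + 1 : ℕ) - (j + 1)) =
      qRatio q (N - (j + 1)) * qInv q ((r + 1 : ℕ) - (j + 1)) := by
    rcases lt_or_ge (((r + 1 : ℕ) : ℤ) - (j + 1)) 0 with h | h
    · rw [qInv_of_neg q h]; simp
    · rw [show (N : ℤ) - (j + 1) = N - j - 1 by ring,
        ← qRatio_sub_one hq (by push_cast at h; omega : (0 : ℤ) < N - j), zpow_sub₀ h0,
        zpow_natCast]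
  have e1 : V j = (q ^ j)⁻¹ * (1 - q ^ (r + 1) * q ^ d * q ^ j) *
        (1 + q ^ N * q ^ d * q ^ j + (q ^ N * q ^ d * q ^ j) ^ 2) * bilateralWeight q N d j *
      (qInv q ((r + 1 : ℕ) - j) * qInv q ((r + 1 : ℕ) + d + j)) := by
    simp only [hV, bilateralWeight]
    rw [← i1] at hfst ⊢
    linear_combination (-(qTri q j * q ^ (j * j + d * j) * (q ^ j)⁻¹ * qRatio q (N - j) *
      qInv q ((r + 1 : ℕ) - j))) * hfst
  have e2 : V (j + 1) = -(q ^ d * (q ^ j) ^ 2 * (1 - q ^ (r + 1) / q ^ j) *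
        (1 + q ^ N / q ^ j + (q ^ N / q ^ j) ^ 2) * bilateralWeight q N d j *
      (qInv q ((r + 1 : ℕ) - j) * qInv q ((r + 1 : ℕ) + d + j))) := by
    simp only [hV, bilateralWeight]
    rw [qTri_add_one h0, zpow_add_one₀ h0,
      show (j + 1) * (j + 1) + d * (j + 1) = (j * j + d * j) + j + j + 1 + d by ring,
      zpow_add₀ h0 _ (d : ℤ), zpow_add_one₀ h0, zpow_add₀ h0 _ j, zpow_add₀ h0 _ j, zpow_natCast,
      show (N : ℤ) + d + (j + 1) - 1 = N + d + j by ring,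
      show (r : ℤ) + d + (j + 1) = (r + 1 : ℕ) + d + j by push_cast; ring]
    rw [← i2] at hsnd ⊢
    have h1 : -q ^ j * qTri q j * (q ^ (j * j + d * j) * q ^ j * q ^ j * q * q ^ d) *
        (q ^ j * q)⁻¹ = -(q ^ d * (q ^ j) ^ 2 * (qTri q j * q ^ (j * j + d * j))) := by
      field_simp
    rw [h1]
    linear_combination (q ^ d * (q ^ j) ^ 2 * (qTri q j * q ^ (j * j + d * j)) *
      qRatio q (N + d + j) * qInv q ((r + 1 : ℕ) + d + j)) * hsnd
  rw [e1, e2]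
  ring

/-- The bilateral sum expressing a unit Bailey pair relative to `q^d`. -/
noncomputable def bilateralSum (q : ℂ) (N d r : ℕ) : ℂ :=
  ∑' j : ℤ, bilateralWeight q N d j * (qInv q (r - j) * qInv q (r + d + j))

/-- Raising the kernel to level r + 1 lets both sides of the recurrence be compared term by term. -/
theorem bilateralSum_eq_tsum_succ {q : ℂ} (h0 : q ≠ 0) (hq : ‖q‖ < 1) (N d r : ℕ) :
    bilateralSum q N d r = ∑' j : ℤ, (1 - q ^ (r + 1) / q ^ j) *
      (1 - q ^ (r + 1) * q ^ d * q ^ j) * bilateralWeight q N d j *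
      (qInv q ((r + 1 : ℕ) - j) * qInv q ((r + 1 : ℕ) + d + j)) := by
  refine tsum_congr fun j => ?_
  have i1 := one_sub_zpow_mul_qInv hq ((r + 1 : ℕ) + d + j)
  have i2 := one_sub_zpow_mul_qInv hq ((r + 1 : ℕ) - j)
  rw [zpow_add₀ h0, zpow_add₀ h0, zpow_natCast, zpow_natCast,
    show ((r + 1 : ℕ) : ℤ) + d + j - 1 = r + d + j by push_cast; ring] at i1
  rw [zpow_sub₀ h0, zpow_natCast,
    show ((r + 1 : ℕ) : ℤ) - j - 1 = r - j by push_cast; ring] at i2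
  rw [← i1, ← i2]
  ring

/-- Reduces the recurrence for `bilateralSum` to an antisymmetry check. -/
theorem bilateralSum_succ_of_antisymm {q : ℂ} (h0 : q ≠ 0) (hq : ‖q‖ < 1) {N r d : ℕ}
    (hr : r + 1 ≤ N) (κ : ℂ) (R : ℂ → ℂ)
    (hR : ∀ x : ℂ, x ≠ 0 →
      (1 - q ^ (r + 1)) * (1 + q ^ (r + 1) * q ^ d * q ^ N + (q ^ (r + 1) * q ^ d * q ^ N) ^ 2) -
        (1 - q ^ d * (q ^ N) ^ 2 * q ^ (r + 1)) *
          ((1 - q ^ (r + 1) / x) * (1 - q ^ (r + 1) * q ^ d * x)) =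
      κ * (x⁻¹ * (1 - q ^ (r + 1) * q ^ d * x) *
        (1 + q ^ N * q ^ d * x + (q ^ N * q ^ d * x) ^ 2) +
      q ^ d * x ^ 2 * (1 - q ^ (r + 1) / x) * (1 + q ^ N / x + (q ^ N / x) ^ 2)) + R x)
    (hanti : ∀ j : ℤ, R (q ^ (-d - j)) * bilateralWeight q N d (-d - j) =
      -(R (q ^ j) * bilateralWeight q N d j)) :
    (1 - q ^ (r + 1)) * (1 + q ^ (r + 1) * q ^ d * q ^ N + (q ^ (r + 1) * q ^ d * q ^ N) ^ 2) *
      bilateralSum q N d (r + 1) =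
    (1 - q ^ d * (q ^ N) ^ 2 * q ^ (r + 1)) * bilateralSum q N d r := by
  have hs : ∀ F : ℤ → ℂ, Summable fun j => F j *
      (qInv q ((r + 1 : ℕ) - j) * qInv q ((r + 1 : ℕ) + d + j)) := fun F =>
    summable_mul_qInv_mul_qInv q F (r + 1 : ℕ) ((r + 1 : ℕ) + d)
  have hRz : ∑' j : ℤ, R (q ^ j) * bilateralWeight q N d j *
      (qInv q ((r + 1 : ℕ) - j) * qInv q ((r + 1 : ℕ) + d + j)) = 0 := by
    refine tsum_eq_zero_of_antisymm (-d) fun j => ?_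
    rw [hanti, show ((r + 1 : ℕ) : ℤ) - (-d - j) = (r + 1 : ℕ) + d + j by ring,
      show ((r + 1 : ℕ) : ℤ) + d + (-d - j) = (r + 1 : ℕ) - j by ring]
    ring
  have htel := tsum_bilateral_telescope h0 hq d hr
  rw [bilateralSum_eq_tsum_succ h0 hq N d r, bilateralSum, ← sub_eq_zero, ← tsum_mul_left,
    ← tsum_mul_left]
  -- The zero is written as κ times the telescoping sum plus the antisymmetric sum, reducing the
  -- claim to the Laurent polynomial identity `hR` at x = q^j.
  have hzero : κ * 0 + 0 = (0 : ℂ) := by ring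
  rw [← hzero]
  nth_rewrite 1 [← htel]
  rw [← hRz, ← tsum_mul_left, ← Summable.tsum_sub ((hs _).mul_left _) ((hs _).mul_left _),
    ← Summable.tsum_add ((hs _).mul_left _) (hs _)]
  refine tsum_congr fun j => ?_
  have := hR (q ^ j) (zpow_ne_zero _ h0)
  linear_combination (bilateralWeight q N d j *
    (qInv q ((r + 1 : ℕ) - j) * qInv q ((r + 1 : ℕ) + d + j))) * this

theorem bilateralSum_succ {q : ℂ} (h0 : q ≠ 0) (hq : ‖q‖ < 1) {N r d : ℕ} (hd : d ≤ 1)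
    (hr : r + 1 ≤ N) :
    (1 - q ^ (r + 1)) * (1 + q ^ (r + 1) * q ^ d * q ^ N + (q ^ (r + 1) * q ^ d * q ^ N) ^ 2) *
      bilateralSum q N d (r + 1) =
    (1 - q ^ d * (q ^ N) ^ 2 * q ^ (r + 1)) * bilateralSum q N d r := by
  generalize hX : q ^ N = X
  obtain rfl | rfl : d = 0 ∨ d = 1 := by omega
  -- As the weight gains a factor x under j ↦ -j, admissible remainders include 1 - x and 1/x - x².
  -- The left side has no x² term; matching x² and 1/x yields κ = q^{r+1}/2.
  · have := bilateralSum_succ_of_antisymm (d := 0) h0 hq hr (q ^ (r + 1) / 2)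
      (fun x => (1 - x) * (q ^ (r + 1) * (q ^ N - q ^ (r + 1)) * (1 + q ^ N) / 2 -
        q ^ (r + 1) * (1 - q ^ (r + 1) * (q ^ N) ^ 2)) +
        q ^ (r + 1) * (1 - q ^ (r + 1) * (q ^ N) ^ 2) / 2 * (1 / x - x ^ 2)) ?_ ?_
    · rwa [hX] at this
    · intro x hx
      field_simp
      ring
    · intro j
      have hj : q ^ j ≠ 0 := zpow_ne_zero _ h0
      push_cast
      rw [show -0 - j = -j by ring, bilateralWeight_neg h0, zpow_neg]
      field_simp
      ring
  -- Here the weight gains -q x² under j ↦ -1 - j, so x and 1 + q x² are admissible. Neither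
  -- contains 1/x, and that coefficient yields κ = q^{r+1}.
  · have := bilateralSum_succ_of_antisymm (d := 1) h0 hq hr (q ^ (r + 1))
      (fun x => q ^ (r + 1) * q * (q ^ (r + 1) * (q ^ N) ^ 2 * (q - 1) * (1 + q * x ^ 2) +
        (1 - q ^ (r + 1) * q * (q ^ N) ^ 2 - q ^ N - q * (q ^ N) ^ 2 + q ^ (r + 1) +
          q ^ (r + 1) * q * q ^ N) * x) -
        q ^ (r + 1) * (1 - q ^ (r + 1) * q * (q ^ N) ^ 2) * (1 + q * x ^ 2)) ?_ ?_
    · rwa [hX] at this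
    · intro x hx
      field_simp
      ring
    · intro j
      have hj : q ^ j ≠ 0 := zpow_ne_zero _ h0
      push_cast
      rw [bilateralWeight_neg_sub_one h0, zpow_sub₀ h0, zpow_neg_one]
      field_simp
      ring

theorem bilateralSum_zero {q : ℂ} (hq : ‖q‖ < 1) (N : ℕ) {d : ℕ} (hd : d ≤ 1) :
    bilateralSum q N d 0 = qRatio q N * qRatio q (N + d) := by
  obtain rfl | rfl : d = 0 ∨ d = 1 := by omega
  · rw [bilateralSum, tsum_eq_single 0]
    · simp [bilateralWeight, qTri_zero, qInv_zero]
    · intro j hj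
      rcases lt_or_gt_of_ne hj with h | h
      · rw [qInv_of_neg q (by push_cast; omega : ((0 : ℕ) : ℤ) + (0 : ℕ) + j < 0)]; simp
      · rw [qInv_of_neg q (by push_cast; omega : ((0 : ℕ) : ℤ) - j < 0)]; simp
  -- For d = 1 both j = 0 and j = -1 survive, contributing 1/(1-q) and -q/(1-q) times the same ratio
  -- product.
  · rw [bilateralSum, tsum_eq_sum (s := {0, -1})]
    · have h1 := one_sub_zpow_mul_qInv hq 1
      rw [sub_self, qInv_zero, zpow_one] at h1
      have h2 : qTri q (-1) = -q := by
        rw [qTri]; norm_num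
      rw [Finset.sum_pair (by norm_num), bilateralWeight, bilateralWeight, h2]
      simp only [qTri_zero, qInv_zero, Nat.cast_zero, Nat.cast_one, sub_zero, add_zero, zero_add,
        mul_zero, neg_neg, zpow_zero, mul_one, one_mul, add_neg_cancel, sub_neg_eq_add,
        neg_mul, mul_neg, add_neg_cancel_right]
      linear_combination (qRatio q N * qRatio q (N + 1)) * h1
    · intro j hj
      simp only [Finset.mem_insert, Finset.mem_singleton, not_or] at hj
      rcases lt_or_gt_of_ne hj.1 with h | h
      · rw [qInv_of_neg q (by push_cast; omega : ((0 : ℕ) : ℤ) + (1 : ℕ) + j < 0)]; simp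
      · rw [qInv_of_neg q (by push_cast; omega : ((0 : ℕ) : ℤ) - j < 0)]; simp

theorem bilateralSum_eq {q : ℂ} (h0 : q ≠ 0) (hq : ‖q‖ < 1) {N r d : ℕ} (hd : d ≤ 1)
    (hr : r ≤ N) :
    bilateralSum q N d r = qPoch q q (2 * N + d + r) * (qPoch q q (2 * N + d))⁻¹ *
      (qPoch q q r)⁻¹ * (qRatio q N * qRatio q ((N + d + r : ℕ))) := by
  induction r with
  | zero =>
    rw [bilateralSum_zero hq N hd, add_zero, mul_inv_cancel₀ (qPoch_self_ne_zero hq _), qPoch_zero]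
    push_cast
    simp
  | succ r ih =>
    have h1 := bilateralSum_succ h0 hq hd hr
    rw [ih (by omega)] at h1
    have h2 := qRatio_add_one hq (N + d + r)
    have h3 := one_sub_pow_succ_ne_zero hq r
    have h4 : 1 + q ^ (N + d + r + 1) + (q ^ (N + d + r + 1)) ^ 2 ≠ 0 := by
      intro h
      have h5 := one_sub_pow_succ_ne_zero (norm_pow_lt_one hq three_ne_zero) (N + d + r)
      apply h5
      linear_combination (1 - q ^ (N + d + r + 1)) * h
    have e1 : q ^ (r + 1) * q ^ d * q ^ N = q ^ (N + d + r + 1) := by ring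
    have e2 : q ^ d * (q ^ N) ^ 2 * q ^ (r + 1) = q ^ (2 * N + d + r + 1) := by ring
    rw [e1, e2, ← h2] at h1
    refine mul_left_cancel₀ (mul_ne_zero h3 h4) (h1.trans ?_)
    rw [show 2 * N + d + (r + 1) = 2 * N + d + r + 1 by ring,
      show N + d + (r + 1) = N + d + r + 1 by ring, qPoch_self_succ, qPoch_self_succ]
    have h6 := qPoch_self_ne_zero hq r
    push_cast
    field_simp

/-! ### Inverse q-Vandermonde and the change to base q³ -/

/-- The inverse `q`-Vandermonde sum. -/
theorem sum_qTri_mul_qInv {q : ℂ} (h0 : q ≠ 0) (hq : ‖q‖ < 1) (M c : ℕ) :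
    ∑ k ∈ Finset.range (M + 1), qTri q (M - k) *
      (qInv q (M - k) * qInv q k * qInv q (k + c)) =
      q ^ (M * (M + c)) * (qInv q M * qInv q (M + c)) := by
  induction M generalizing c with
  | zero => simp [qInv_zero, qTri_zero]
  | succ M ih =>
    have hM := one_sub_pow_succ_ne_zero hq M
    have hrec : ∀ n : ℕ, (1 - q ^ (n + 1)) * qInv q (n + 1) = qInv q n := fun n => by
      have := one_sub_zpow_mul_qInv hq (n + 1)
      rw [add_sub_cancel_right] at this
      rw [← this]; norm_cast
    -- Again 1 - q^{M+1} = q^k (1 - q^{M+1-k}) + (1 - q^k); the two parts become the instances (M,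
    -- c) and (M, c+1).
    have h1 : (1 - q ^ (M + 1)) * ∑ k ∈ Finset.range (M + 2), qTri q ((M + 1 : ℕ) - k) *
        (qInv q ((M + 1 : ℕ) - k) * qInv q k * qInv q (k + c)) =
        -q ^ M * ∑ k ∈ Finset.range (M + 2), qTri q (M - k) *
          (qInv q (M - k) * qInv q k * qInv q (k + c)) +
        ∑ k ∈ Finset.range (M + 2), qTri q ((M + 1 : ℕ) - k) *
        (qInv q ((M + 1 : ℕ) - k) * ((1 - q ^ k) * qInv q k) * qInv q (k + c)) := by
      rw [Finset.mul_sum, Finset.mul_sum, ← Finset.sum_add_distrib]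
      refine Finset.sum_congr rfl fun k hk => ?_
      have e1 : ((M + 1 : ℕ) : ℤ) - k = (M - k) + 1 := by push_cast; ring
      have e2 := one_sub_zpow_mul_qInv hq ((M : ℤ) - k + 1)
      rw [add_sub_cancel_right] at e2
      have hk0 : q ^ k ≠ 0 := pow_ne_zero _ h0
      have e3 : q ^ ((M : ℤ) - k) = q ^ M / q ^ k := by
        rw [zpow_sub₀ h0, zpow_natCast, zpow_natCast]
      rw [zpow_add_one₀ h0, e3] at e2
      rw [e1, qTri_add_one h0, ← e2, e3, pow_succ]
      field_simp
      ring
    have h2 : ∑ k ∈ Finset.range (M + 2), qTri q (M - k) *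
        (qInv q (M - k) * qInv q k * qInv q (k + c)) =
        ∑ k ∈ Finset.range (M + 1), qTri q (M - k) *
        (qInv q (M - k) * qInv q k * qInv q (k + c)) := by
      rw [Finset.sum_range_succ _ (M + 1),
        qInv_of_neg q (by push_cast; omega : (M : ℤ) - (M + 1 : ℕ) < 0)]
      simp
    have h3 : ∑ k ∈ Finset.range (M + 2), qTri q ((M + 1 : ℕ) - k) *
        (qInv q ((M + 1 : ℕ) - k) * ((1 - q ^ k) * qInv q k) * qInv q (k + c)) =
        ∑ k ∈ Finset.range (M + 1), qTri q (M - k) *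
        (qInv q (M - k) * qInv q k * qInv q (k + (c + 1 : ℕ))) := by
      rw [Finset.sum_range_succ']
      simp only [pow_zero, sub_self, zero_mul, mul_zero, add_zero]
      refine Finset.sum_congr rfl fun k _ => ?_
      have e1 := hrec k
      rw [show ((M + 1 : ℕ) : ℤ) - (k + 1 : ℕ) = M - k by push_cast; ring,
        show ((k + 1 : ℕ) : ℤ) + c = k + (c + 1 : ℕ) by push_cast; ring]
      push_cast
      rw [e1]
    have h4 := hrec M
    have h5 := hrec (M + c)
    rw [h2, h3, ih, ih] at h1
    refine mul_left_cancel₀ hM (h1.trans ?_)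
    rw [show (M : ℤ) + (c + 1 : ℕ) = (M + c : ℕ) + 1 by push_cast; ring,
      show (M : ℤ) + c = (M + c : ℕ) by push_cast; ring,
      show ((M + 1 : ℕ) : ℤ) + c = (M + c : ℕ) + 1 by push_cast; ring, ← h5,
      show ((M + 1 : ℕ) : ℤ) = M + 1 by push_cast; ring, ← h4]
    ring

theorem sum_qTri_mul_qInv_sub_mul_qInv_add_of_nonneg {q : ℂ} (h0 : q ≠ 0) (hq : ‖q‖ < 1)
    (N d j : ℕ) :
    ∑ r ∈ Finset.range (N + 1), qTri q (N - r) * qInv q (N - r) *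
      (qInv q (r - j) * qInv q (r + d + j)) =
      q ^ (((N : ℤ) - j) * (N + d + j)) * (qInv q (N - j) * qInv q (N + d + j)) := by
  rcases lt_or_ge N j with h | h
  · rw [qInv_of_neg q (by omega : (N : ℤ) - j < 0), zero_mul, mul_zero]
    refine Finset.sum_eq_zero fun r hr => ?_
    have := Finset.mem_range.mp hr
    rw [qInv_of_neg q (by omega : (r : ℤ) - j < 0)]
    simp
  · obtain ⟨M, rfl⟩ := Nat.exists_eq_add_of_le h
    have := sum_qTri_mul_qInv h0 hq M (2 * j + d)
    have e1 : ((j + M : ℕ) : ℤ) - j = M := by push_cast; ring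
    have e2 : ((j + M : ℕ) : ℤ) + d + j = M + (2 * j + d : ℕ) := by push_cast; ring
    have e3 : q ^ ((M : ℤ) * (M + (2 * j + d : ℕ))) = q ^ (M * (M + (2 * j + d))) := by
      rw [← zpow_natCast]; push_cast; rfl
    rw [e1, e2, e3, ← this, show j + M + 1 = j + (M + 1) by ring, Finset.sum_range_add]
    rw [Finset.sum_eq_zero, zero_add]
    · refine Finset.sum_congr rfl fun k _ => ?_
      rw [show ((j + M : ℕ) : ℤ) - (j + k : ℕ) = M - k by push_cast; ring,
        show ((j + k : ℕ) : ℤ) - j = k by push_cast; ring,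
        show ((j + k : ℕ) : ℤ) + d + j = k + (2 * j + d : ℕ) by push_cast; ring]
      ring
    · intro r hr
      have := Finset.mem_range.mp hr
      rw [qInv_of_neg q (by omega : (r : ℤ) - j < 0)]
      simp

theorem sum_qTri_mul_qInv_sub_mul_qInv_add {q : ℂ} (h0 : q ≠ 0) (hq : ‖q‖ < 1) (N : ℕ) {d : ℕ}
    (hd : d ≤ 1) (j : ℤ) :
    ∑ r ∈ Finset.range (N + 1), qTri q (N - r) * qInv q (N - r) *
      (qInv q (r - j) * qInv q (r + d + j)) =
      q ^ (((N : ℤ) - j) * (N + d + j)) * (qInv q (N - j) * qInv q (N + d + j)) := by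
  rcases le_or_gt 0 j with h | h
  · lift j to ℕ using h
    exact sum_qTri_mul_qInv_sub_mul_qInv_add_of_nonneg h0 hq N d j
  · obtain ⟨i, hi⟩ : ∃ i : ℕ, -j - d = i := ⟨(-j - d).toNat, by omega⟩
    obtain rfl : j = -i - d := by omega
    have := sum_qTri_mul_qInv_sub_mul_qInv_add_of_nonneg h0 hq N d i
    have e : ∀ r : ℤ, r - (-i - d) = r + d + i := fun r => by ring
    have e' : ∀ r : ℤ, r + d + (-i - d) = r - i := fun r => by ring
    simp only [e, e']
    rw [mul_comm ((N : ℤ) + d + i), mul_comm (qInv q (N + d + i)), ← this]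
    exact Finset.sum_congr rfl fun r _ => by ring

/-- The inner sum of the double series, as a bilateral sum in base `q³`. -/
theorem sum_qTri_mul_bilateralSum {q : ℂ} (h0 : q ≠ 0) (hq : ‖q‖ < 1) (N : ℕ) {d : ℕ}
    (hd : d ≤ 1) :
    ∑ r ∈ Finset.range (N + 1), qTri q (N - r) * qInv q (N - r) * bilateralSum q N d r =
      q ^ (N * N + d * N) *
        ∑' j : ℤ, qTri q j * (qInv (q ^ 3) (N - j) * qInv (q ^ 3) (N + d + j)) := by
  simp only [bilateralSum, ← tsum_mul_left]
  have hs : ∀ r : ℕ, Summable fun j : ℤ => qTri q (N - r) * qInv q (N - r) *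
      (bilateralWeight q N d j * (qInv q (r - j) * qInv q (r + d + j))) := fun r =>
    (summable_mul_qInv_mul_qInv q (bilateralWeight q N d) r (r + d)).mul_left _
  rw [← Summable.tsum_finsetSum fun r _ => hs r]
  refine tsum_congr fun j => ?_
  have h := sum_qTri_mul_qInv_sub_mul_qInv_add h0 hq N hd j
  have h1 : ∀ r : ℕ, qTri q (N - r) * qInv q (N - r) *
      (bilateralWeight q N d j * (qInv q (r - j) * qInv q (r + d + j))) =
      bilateralWeight q N d j * (qTri q (N - r) * qInv q (N - r) *
      (qInv q (r - j) * qInv q (r + d + j))) := fun r => by ring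
  rw [Finset.sum_congr rfl fun r _ => h1 r, ← Finset.mul_sum, h, bilateralWeight,
    ← qInv_mul_qRatio hq, ← qInv_mul_qRatio hq]
  -- Since (N - j)(N + d + j) = N² + dN - j² - dj, the quadratic power of j in the weight is exactly
  -- absorbed.
  have e : q ^ (N * N + d * N) = q ^ (j * j + d * j) * q ^ (((N : ℤ) - j) * (N + d + j)) := by
    rw [← zpow_natCast, ← zpow_add₀ h0]; congr 1; push_cast; ring
  rw [e]
  ring

/-! ### The summands and their antidiagonal sums -/

theorem exists_sq_eq_add_two_mul (n : ℕ) : ∃ k, n ^ 2 = n + 2 * k := by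
  obtain ⟨k, hk⟩ := Nat.even_mul_succ_self n
  refine ⟨k - n, ?_⟩
  have : n * (n + 1) = n ^ 2 + n := by ring
  have : n ≤ n ^ 2 := Nat.le_self_pow two_ne_zero n
  omega

theorem qTri_natCast (q : ℂ) {n k : ℕ} (hk : n ^ 2 = n + 2 * k) :
    qTri q n = (-1) ^ n * q ^ k := by
  have : (n : ℤ) * (n - 1) / 2 = k := by
    have : (n : ℤ) ^ 2 = n + 2 * k := by exact_mod_cast hk
    rw [show (n : ℤ) * (n - 1) = k * 2 by linear_combination this]
    exact Int.mul_ediv_cancel _ two_ne_zero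
  rw [qTri, this, zpow_natCast, zpow_natCast]

theorem summand₃_eq {q : ℂ} (h0 : q ≠ 0) (hq : ‖q‖ < 1) (n r : ℕ) :
    summand₃ q n r = q ^ (2 * ((n + r) * (n + r))) *
      (qTri q n * qInv q n * bilateralSum q (n + r) 0 r) := by
  obtain ⟨k, hk⟩ := exists_sq_eq_add_two_mul n
  have e : (5 * n ^ 2 - n) / 2 + 4 * n * r + 2 * r ^ 2 = 2 * ((n + r) * (n + r)) + k := by
    have h1 : (5 * n ^ 2 - n) / 2 = 2 * n ^ 2 + k := by omega
    rw [h1]; ring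
  rw [bilateralSum_eq h0 hq zero_le_one (Nat.le_add_left r n), qTri_natCast q hk, qInv_natCast,
    qRatio_natCast, qRatio_natCast, summand₃, e, pow_add]
  simp only [add_zero]
  rw [show 2 * (n + r) + r = 2 * n + 3 * r by ring, show n + r + r = n + 2 * r by ring,
    show 2 * (n + r) = 2 * n + 2 * r by ring, div_eq_mul_inv]
  simp only [mul_inv]
  ring

theorem summand₁_eq {q : ℂ} (h0 : q ≠ 0) (hq : ‖q‖ < 1) (n r : ℕ) :
    summand₁ q n r = q ^ (2 * ((n + r) * (n + r) + (n + r))) *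
      (qTri q n * qInv q n * bilateralSum q (n + r) 1 r) := by
  obtain ⟨k, hk⟩ := exists_sq_eq_add_two_mul n
  have e : (5 * n ^ 2 + 3 * n) / 2 + 4 * n * r + 2 * r ^ 2 + 2 * r =
      2 * ((n + r) * (n + r) + (n + r)) + k := by
    have h1 : (5 * n ^ 2 + 3 * n) / 2 = 2 * n ^ 2 + 2 * n + k := by omega
    rw [h1]; ring
  rw [bilateralSum_eq h0 hq le_rfl (Nat.le_add_left r n), qTri_natCast q hk, qInv_natCast,
    qRatio_natCast, qRatio_natCast, summand₁, e, pow_add]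
  rw [show 2 * (n + r) + 1 + r = 2 * n + 3 * r + 1 by ring,
    show n + r + 1 + r = n + 2 * r + 1 by ring,
    show 2 * (n + r) + 1 = 2 * n + 2 * r + 1 by ring, div_eq_mul_inv]
  simp only [mul_inv]
  ring

/-- The factor 1 + q^{N+1} cancels against 1 - q^{2N+2} = (1 - q^{N+1})(1 + q^{N+1}). The remaining
ratio depends only on N = n + r, so it leaves antidiagonal sums. -/
theorem summand₂_eq {q : ℂ} (hq : ‖q‖ < 1) (n r : ℕ) :
    summand₂ q n r = q ^ (3 * (n + r) + 2) / (1 - (q ^ 3) ^ (n + r + 1)) * summand₁ q n r := by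
  have e : (5 * n ^ 2 + 9 * n) / 2 + 4 * n * r + 2 * r ^ 2 + 5 * r + 2 =
      (3 * (n + r) + 2) + ((5 * n ^ 2 + 3 * n) / 2 + 4 * n * r + 2 * r ^ 2 + 2 * r) := by
    omega
  have h3 := norm_pow_lt_one hq three_ne_zero
  have e2 : 1 - q ^ (2 * n + 2 * r + 1 + 1) =
      (1 - q ^ (n + r + 1)) * (1 + q ^ (n + r + 1)) := by ring
  have hne := one_sub_pow_succ_ne_zero hq (2 * n + 2 * r + 1)
  rw [summand₂, summand₁, e, pow_add, qPoch_self_succ q (n + r), qPoch_self_succ (q ^ 3) (n + r),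
    qPoch_self_succ q (2 * n + 2 * r + 1), e2]
  rw [e2] at hne
  obtain ⟨h4, h5⟩ := mul_ne_zero_iff.mp hne
  have h6 := one_sub_pow_succ_ne_zero h3 (n + r)
  have h7 := qPoch_self_ne_zero hq
  have h8 := qPoch_self_ne_zero h3
  have := h7 n
  have := h7 r
  have := h7 (2 * n + 2 * r + 1)
  have := h8 (n + r)
  have := h8 (n + 2 * r + 1)
  field_simp

theorem sum_antidiagonal_bilateralSum {q : ℂ} (h0 : q ≠ 0) (hq : ‖q‖ < 1) (N : ℕ) {d : ℕ}
    (hd : d ≤ 1) :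
    ∑ p ∈ Finset.HasAntidiagonal.antidiagonal N,
      q ^ (2 * ((p.1 + p.2) * (p.1 + p.2) + d * (p.1 + p.2))) *
        (qTri q p.1 * qInv q p.1 * bilateralSum q (p.1 + p.2) d p.2) =
      (q ^ 3) ^ (N * N + d * N) *
        ∑' j : ℤ, qTri q j * (qInv (q ^ 3) (N - j) * qInv (q ^ 3) (N + d + j)) := by
  have h := sum_qTri_mul_bilateralSum h0 hq N hd
  rw [← Finset.Nat.sum_antidiagonal_swap, Finset.Nat.sum_antidiagonal_eq_sum_range_succ_mk,
    ← pow_mul, show 3 * (N * N + d * N) = 2 * (N * N + d * N) + (N * N + d * N) by ring, pow_add,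
    mul_assoc, ← h, Finset.mul_sum]
  refine Finset.sum_congr rfl fun r hr => ?_
  have hr' : r ≤ N := Nat.lt_succ_iff.mp (Finset.mem_range.mp hr)
  simp only [Prod.swap_prod_mk, Nat.sub_add_cancel hr', Nat.cast_sub hr']

theorem sum_antidiagonal_summand₃ {q : ℂ} (h0 : q ≠ 0) (hq : ‖q‖ < 1) (N : ℕ) :
    ∑ p ∈ Finset.HasAntidiagonal.antidiagonal N, summand₃ q p.1 p.2 =
      (q ^ 3) ^ (N * N + 0 * N) *
        ∑' j : ℤ, qTri q j * (qInv (q ^ 3) (N - j) * qInv (q ^ 3) (N + (0 : ℕ) + j)) := by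
  rw [← sum_antidiagonal_bilateralSum h0 hq N zero_le_one]
  refine Finset.sum_congr rfl fun p _ => ?_
  rw [summand₃_eq h0 hq, zero_mul, add_zero]

theorem sum_antidiagonal_summand₁ {q : ℂ} (h0 : q ≠ 0) (hq : ‖q‖ < 1) (N : ℕ) :
    ∑ p ∈ Finset.HasAntidiagonal.antidiagonal N, summand₁ q p.1 p.2 =
      (q ^ 3) ^ (N * N + 1 * N) *
        ∑' j : ℤ, qTri q j * (qInv (q ^ 3) (N - j) * qInv (q ^ 3) (N + (1 : ℕ) + j)) := by
  rw [← sum_antidiagonal_bilateralSum h0 hq N le_rfl]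
  refine Finset.sum_congr rfl fun p _ => ?_
  rw [summand₁_eq h0 hq, one_mul]

/-- Two reflections give this: j ↦ -j relates the d = 0 kernel at level M + 1 to the d = 1 kernel at
level M, and j ↦ -1 - j then removes the weight q^{2j}. -/
theorem tsum_qTri_mul_zpow_two_mul_eq {q : ℂ} (h0 : q ≠ 0) (hq : ‖q‖ < 1) (M : ℕ) :
    (1 - (q ^ 3) ^ (M + 1)) * ∑' j : ℤ, qTri q j * q ^ (2 * j) *
        (qInv (q ^ 3) ((M + 1 : ℕ) - j) * qInv (q ^ 3) ((M + 1 : ℕ) + j)) =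
      -q⁻¹ * ∑' j : ℤ, qTri q j * (qInv (q ^ 3) (M - j) * qInv (q ^ 3) (M + 1 + j)) := by
  have hp := norm_pow_lt_one hq three_ne_zero
  have hp0 : q ^ 3 ≠ 0 := pow_ne_zero 3 h0
  generalize hpq : q ^ 3 = p at *
  set P := p ^ (M + 1) with hP
  set B : ℤ → ℂ := fun j => qTri q j * q ^ (2 * j) * (qInv p (M - j) * qInv p (M + 1 + j)) with hB
  set A : ℤ → ℂ := fun j => qTri q j * q ^ (2 * j) *
    (qInv p ((M + 1 : ℕ) - j) * qInv p ((M + 1 : ℕ) + j)) with hA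
  set G : ℤ → ℂ := fun j => qTri q j * (qInv p (M - j) * qInv p (M + 1 + j)) with hG
  have hBs : Summable B := summable_mul_qInv_mul_qInv p _ M (M + 1)
  -- With x = q^j this is x²(1 - P/x³) + (P/x)(1 - P x³) = (1 - P²) x².
  have hterm : ∀ j, (1 - P * P) * A j = B j + P * B (-j) := by
    intro j
    have i1 := one_sub_zpow_mul_qInv hp ((M + 1 : ℕ) - j)
    have i2 := one_sub_zpow_mul_qInv hp ((M + 1 : ℕ) + j)
    rw [zpow_sub₀ hp0, zpow_natCast,
      show ((M + 1 : ℕ) : ℤ) - j - 1 = M - j by push_cast; ring] at i1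
    rw [zpow_add₀ hp0, zpow_natCast,
      show ((M + 1 : ℕ) : ℤ) + j - 1 = M - -j by push_cast; ring] at i2
    have hj : q ^ j ≠ 0 := zpow_ne_zero _ h0
    have e1 : p ^ j = (q ^ j) ^ 3 := by
      rw [← hpq, ← zpow_natCast, ← zpow_natCast, zpow_comm]
    have e2 : q ^ (2 * j) = (q ^ j) ^ 2 := by rw [mul_comm, zpow_mul]; norm_cast
    have e3 : q ^ (2 * -j) = ((q ^ j) ^ 2)⁻¹ := by rw [← e2, ← zpow_neg]; congr 1; ring
    simp only [hA, hB]
    rw [qTri_neg h0, ← i1, ← i2, e1, e2, e3,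
      show (M : ℤ) + 1 + j = (M + 1 : ℕ) + j by push_cast; ring,
      show (M : ℤ) + 1 + -j = (M + 1 : ℕ) - j by push_cast; ring]
    field_simp
    ring
  have hBneg : ∑' j, B (-j) = ∑' j, B j := by
    rw [← tsum_int_reflect B 0]; simp
  have hBs' : Summable fun j => B (-j) := (Equiv.neg ℤ).summable_iff.mpr hBs
  have h1 : (1 - P * P) * ∑' j, A j = (1 + P) * ∑' j, B j := by
    rw [← tsum_mul_left, tsum_congr hterm, hBs.tsum_add (hBs'.mul_left _), tsum_mul_left, hBneg]
    ring
  have h2 : ∑' j, B j = -q⁻¹ * ∑' j, G j := by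
    rw [← tsum_int_reflect B (-1), ← tsum_mul_left]
    refine tsum_congr fun j => ?_
    have hj : q ^ j ≠ 0 := zpow_ne_zero _ h0
    simp only [hB, hG]
    rw [qTri_neg_sub_one h0, show 2 * (-1 - j) = -j + -j + -1 + -1 by ring, zpow_add₀ h0,
      zpow_add₀ h0, zpow_add₀ h0, zpow_neg, zpow_neg_one,
      show (M : ℤ) - (-1 - j) = M + 1 + j by ring, show (M : ℤ) + 1 + (-1 - j) = M - j by ring]
    field_simp
  have hP1 : 1 + P ≠ 0 := by
    intro h
    have := one_sub_pow_succ_ne_zero hp (2 * M + 1)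
    apply this
    have e : p ^ (2 * M + 1 + 1) = P * P := by rw [hP]; ring
    rw [e]
    linear_combination (1 - P) * h
  rw [← h2]
  refine mul_left_cancel₀ hP1 (Eq.trans ?_ h1)
  ring

theorem sum_antidiagonal_summand₂ {q : ℂ} (h0 : q ≠ 0) (hq : ‖q‖ < 1) (M : ℕ) :
    (q ^ 3) ^ ((M + 1) * (M + 1) + 0 * (M + 1)) * ∑' j : ℤ, qTri q j * q ^ (2 * j) *
      (qInv (q ^ 3) ((M + 1 : ℕ) - j) * qInv (q ^ 3) ((M + 1 : ℕ) + (0 : ℕ) + j)) =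
      -∑ p ∈ Finset.HasAntidiagonal.antidiagonal M, summand₂ q p.1 p.2 := by
  have h1 := tsum_qTri_mul_zpow_two_mul_eq h0 hq M
  have h2 := sum_antidiagonal_summand₁ h0 hq M
  have h3 := one_sub_pow_succ_ne_zero (norm_pow_lt_one hq three_ne_zero) M
  have h4 : ∑ p ∈ Finset.HasAntidiagonal.antidiagonal M, summand₂ q p.1 p.2 =
      q ^ (3 * M + 2) / (1 - (q ^ 3) ^ (M + 1)) *
        ∑ p ∈ Finset.HasAntidiagonal.antidiagonal M, summand₁ q p.1 p.2 := by
    rw [Finset.mul_sum]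
    refine Finset.sum_congr rfl fun p hp => ?_
    rw [summand₂_eq hq, Finset.HasAntidiagonal.mem_antidiagonal.mp hp]
  rw [h4, h2]
  push_cast at h1 ⊢
  simp only [add_zero]
  refine mul_left_cancel₀ h3 ?_
  rw [mul_left_comm, h1, show (q ^ 3) ^ ((M + 1) * (M + 1) + 0 * (M + 1)) =
    q ^ (3 * M + 2) * q * (q ^ 3) ^ (M * M + 1 * M) by ring]
  field_simp

/-! ### Summation over levels and absolute convergence -/

theorem summable_pow_natAbs {ρ : ℝ} (h0 : 0 ≤ ρ) (h1 : ρ < 1) :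
    Summable fun j : ℤ => ρ ^ j.natAbs := by
  refine Summable.of_nat_of_neg ?_ ?_ <;>
    simpa using summable_geometric_of_lt_one h0 h1

/-- Summation against the limiting Bailey kernel for bounded weights. -/
theorem tsum_pow_mul_tsum_qInv {p : ℂ} (h0 : p ≠ 0) (hp : ‖p‖ < 1) {d : ℕ} (hd : d ≤ 1)
    {w : ℤ → ℂ} {K : ℝ} (hw : ∀ j, ‖w j‖ ≤ K) :
    ∑' N : ℕ, p ^ (N * N + d * N) * ∑' j : ℤ, w j * (qInv p (N - j) * qInv p (N + d + j)) =
      (∑' j : ℤ, w j * p ^ (j * j + d * j)) / qPochInf p p := by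
  obtain ⟨C, hC0, hC⟩ := exists_norm_qInv_le hp
  have hK : 0 ≤ K := (norm_nonneg _).trans (hw 0)
  have hρ : 0 < ‖p‖ := norm_pos_iff.mpr h0
  have hs : Summable (Function.uncurry fun (N : ℕ) (j : ℤ) =>
      p ^ (N * N + d * N) * (w j * (qInv p (N - j) * qInv p (N + d + j)))) := by
    have hg : Summable fun x : ℕ × ℤ => ‖p‖ ^ x.1 * ‖p‖ ^ x.2.natAbs :=
      (summable_geometric_of_lt_one hρ.le hp).mul_of_nonneg (summable_pow_natAbs hρ.le hp)
        (fun _ => pow_nonneg hρ.le _) (fun _ => pow_nonneg hρ.le _)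
    refine Summable.of_norm_bounded (hg.mul_left (K * (C * C) / ‖p‖ ^ 2)) ?_
    rintro ⟨N, j⟩
    simp only [Function.uncurry]
    by_cases hj : -(N + d : ℤ) ≤ j ∧ j ≤ N
    · have hb : ‖p‖ ^ (N * N + d * N) * ‖p‖ ^ 2 ≤ ‖p‖ ^ N * ‖p‖ ^ j.natAbs := by
        rw [← pow_add, ← pow_add]
        refine pow_le_pow_of_le_one hρ.le hp.le ?_
        have h1 : j.natAbs ≤ N + 1 := by omega
        nlinarith [Nat.zero_le (d * N), sq_nonneg ((N : ℤ) - 1)]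
      rw [norm_mul, norm_mul, norm_mul, norm_pow]
      calc ‖p‖ ^ (N * N + d * N) * (‖w j‖ * (‖qInv p (N - j)‖ * ‖qInv p (N + d + j)‖))
          ≤ ‖p‖ ^ (N * N + d * N) * (K * (C * C)) := by
            gcongr
            · exact hw j
            · exact hC _
            · exact hC _
        _ = K * (C * C) / ‖p‖ ^ 2 * (‖p‖ ^ (N * N + d * N) * ‖p‖ ^ 2) := by
            field_simp
        _ ≤ _ := by gcongr
    · have hz : qInv p (N - j) * qInv p (N + d + j) = 0 := by
        rw [not_and_or, not_le, not_le] at hj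
        rcases hj with h | h
        · rw [qInv_of_neg p (by omega : (N : ℤ) + d + j < 0), mul_zero]
        · rw [qInv_of_neg p (by omega : (N : ℤ) - j < 0), zero_mul]
      rw [hz, mul_zero, mul_zero, norm_zero]
      positivity
  simp only [← tsum_mul_left]
  rw [← hs.tsum_comm, div_eq_mul_inv, ← tsum_mul_right]
  refine tsum_congr fun j => ?_
  rw [mul_assoc, ← tsum_pow_mul_qInv_sub_mul_qInv_add hp hd, ← tsum_mul_left]
  exact tsum_congr fun N => by ring

theorem tsum_prod_eq_tsum_sum_antidiagonal {f : ℕ × ℕ → ℂ} (hf : Summable f) :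
    ∑' p, f p = ∑' N, ∑ p ∈ Finset.HasAntidiagonal.antidiagonal N, f p := by
  conv_rhs => congr; ext; rw [← Finset.sum_finset_coe, ← tsum_fintype (L := .unconditional _)]
  rw [← Finset.HasAntidiagonal.sigmaAntidiagonalEquivProd.tsum_eq f]
  exact (Finset.HasAntidiagonal.sigmaAntidiagonalEquivProd.summable_iff.mpr hf).tsum_sigma'
    fun n => (hasSum_fintype _).summable

theorem summable_sum_antidiagonal {f : ℕ × ℕ → ℂ} (hf : Summable f) :
    Summable fun N => ∑ p ∈ Finset.HasAntidiagonal.antidiagonal N, f p := by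
  conv => congr; ext; rw [← Finset.sum_finset_coe, ← tsum_fintype (L := .unconditional _)]
  exact (Finset.HasAntidiagonal.sigmaAntidiagonalEquivProd.summable_iff.mpr hf).sigma'
    fun n => (hasSum_fintype _).summable

theorem summable_of_norm_le_mul_pow {ρ K : ℝ} (h0 : 0 ≤ ρ) (h1 : ρ < 1) {f : ℕ → ℕ → ℂ}
    (hf : ∀ n r, ‖f n r‖ ≤ K * ρ ^ (n + r)) : Summable fun p : ℕ × ℕ => f p.1 p.2 := by
  have hg : Summable fun x : ℕ × ℕ => ρ ^ x.1 * ρ ^ x.2 :=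
    (summable_geometric_of_lt_one h0 h1).mul_of_nonneg (summable_geometric_of_lt_one h0 h1)
      (fun _ => pow_nonneg h0 _) (fun _ => pow_nonneg h0 _)
  refine Summable.of_norm_bounded (hg.mul_left K) fun p => ?_
  rw [← pow_add]
  exact hf _ _

theorem norm_qPoch_quotient_le {q : ℂ} (hq : ‖q‖ < 1) {A C B : ℝ}
    (hA : ∀ n, ‖qPoch q q n‖ ≤ A) (hC : ∀ m, ‖qInv q m‖ ≤ C) (hB : ∀ m, ‖qInv (q ^ 3) m‖ ≤ B)
    {n r e : ℕ} (he : n + r ≤ e) (a b c u v x y z : ℕ) :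
    ‖((-1) ^ n * q ^ e * qPoch q q a * qPoch q q b * qPoch q q c) /
      (qPoch (q ^ 3) (q ^ 3) u * qPoch q q v * qPoch q q x * qPoch (q ^ 3) (q ^ 3) y *
        qPoch q q z)‖ ≤ A * A * A * (B * C * C * B * C) * ‖q‖ ^ (n + r) := by
  have hA0 : 0 ≤ A := (norm_nonneg _).trans (hA 0)
  have hB0 : 0 ≤ B := (norm_nonneg _).trans (hB 0)
  have hC0 : 0 ≤ C := (norm_nonneg _).trans (hC 0)
  have hpow : ‖q‖ ^ e ≤ ‖q‖ ^ (n + r) := pow_le_pow_of_le_one (norm_nonneg q) hq.le he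
  have hC' : ∀ k, ‖qPoch q q k‖⁻¹ ≤ C := fun k => by
    simpa [qInv_natCast] using hC k
  have hB' : ∀ k, ‖qPoch (q ^ 3) (q ^ 3) k‖⁻¹ ≤ B := fun k => by
    simpa [qInv_natCast] using hB k
  simp only [div_eq_mul_inv, mul_inv, norm_mul, norm_inv, norm_pow, norm_neg, norm_one, one_pow,
    one_mul]
  calc ‖q‖ ^ e * ‖qPoch q q a‖ * ‖qPoch q q b‖ * ‖qPoch q q c‖ *
        (‖qPoch (q ^ 3) (q ^ 3) u‖⁻¹ * ‖qPoch q q v‖⁻¹ * ‖qPoch q q x‖⁻¹ *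
          ‖qPoch (q ^ 3) (q ^ 3) y‖⁻¹ * ‖qPoch q q z‖⁻¹)
      ≤ ‖q‖ ^ (n + r) * A * A * A * (B * C * C * B * C) := by
        gcongr <;> apply_assumption
    _ = _ := by ring

theorem exists_norm_qPoch_quotient_le {q : ℂ} (hq : ‖q‖ < 1) :
    ∃ K : ℝ, ∀ n r e : ℕ, n + r ≤ e → ∀ a b c u v x y z : ℕ,
    ‖((-1) ^ n * q ^ e * qPoch q q a * qPoch q q b * qPoch q q c) /
      (qPoch (q ^ 3) (q ^ 3) u * qPoch q q v * qPoch q q x * qPoch (q ^ 3) (q ^ 3) y *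
        qPoch q q z)‖ ≤ K * ‖q‖ ^ (n + r) := by
  obtain ⟨A, -, hA⟩ := exists_norm_qPoch_le hq q
  obtain ⟨C, -, hC⟩ := exists_norm_qInv_le hq
  obtain ⟨B, -, hB⟩ := exists_norm_qInv_le (norm_pow_lt_one hq three_ne_zero)
  exact ⟨_, fun n r e he a b c u v x y z => norm_qPoch_quotient_le hq hA hC hB he a b c u v x y z⟩

theorem summable_summand₁ {q : ℂ} (hq : ‖q‖ < 1) :
    Summable fun p : ℕ × ℕ => summand₁ q p.1 p.2 := by
  obtain ⟨K, hK⟩ := exists_norm_qPoch_quotient_le hq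
  refine summable_of_norm_le_mul_pow (norm_nonneg q) hq (K := K) fun n r => hK n r _ ?_ _ _ _ _ _ _ _ _
  have : n ≤ (5 * n ^ 2 + 3 * n) / 2 := by omega
  omega

theorem summable_summand₂ {q : ℂ} (hq : ‖q‖ < 1) :
    Summable fun p : ℕ × ℕ => summand₂ q p.1 p.2 := by
  obtain ⟨K, hK⟩ := exists_norm_qPoch_quotient_le hq
  refine summable_of_norm_le_mul_pow (norm_nonneg q) hq (K := K * 2) fun n r => ?_
  have h1 : ‖1 + q ^ (n + r + 1)‖ ≤ 2 := by
    have := norm_add_le 1 (q ^ (n + r + 1))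
    have := norm_pow_lt_one hq (Nat.succ_ne_zero (n + r))
    rw [norm_one] at *
    linarith
  rw [summand₂, mul_div_right_comm, norm_mul, mul_right_comm K]
  refine mul_le_mul (hK n r _ ?_ _ _ _ _ _ _ _ _) h1 (norm_nonneg _)
    ((norm_nonneg _).trans (hK n r (n + r) le_rfl 0 0 0 0 0 0 0 0))
  omega

theorem summable_summand₃ {q : ℂ} (hq : ‖q‖ < 1) :
    Summable fun p : ℕ × ℕ => summand₃ q p.1 p.2 := by
  obtain ⟨K, hK⟩ := exists_norm_qPoch_quotient_le hq
  refine summable_of_norm_le_mul_pow (norm_nonneg q) hq (K := K) fun n r => ?_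
  have e : qPoch q q (2 * n + 2 * r) * qPoch q q n * qPoch q q r *
      qPoch (q ^ 3) (q ^ 3) (n + 2 * r) * qPoch (q ^ 3) (q ^ 3) (n + r) =
      qPoch (q ^ 3) (q ^ 3) (n + r) * qPoch q q n * qPoch q q r *
      qPoch (q ^ 3) (q ^ 3) (n + 2 * r) * qPoch q q (2 * n + 2 * r) := by ring
  rw [summand₃, e]
  refine hK n r _ ?_ _ _ _ _ _ _ _ _
  have h1 : n ≤ n ^ 2 := Nat.le_self_pow two_ne_zero n
  have h2 : r ≤ r ^ 2 := Nat.le_self_pow two_ne_zero r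
  have : n ≤ (5 * n ^ 2 - n) / 2 := by omega
  omega

/-! ### The three product formulas -/

/-- The weight is q⁻¹ times the triangular weight at j + 2, so its exponent never drops below -1. -/
theorem norm_qTri_mul_zpow_two_mul_le {q : ℂ} (h0 : q ≠ 0) (hq : ‖q‖ < 1) (j : ℤ) :
    ‖qTri q j * q ^ (2 * j)‖ ≤ ‖q⁻¹‖ := by
  have h : qTri q j * q ^ (2 * j) = q⁻¹ * qTri q (j + 1 + 1) := by
    rw [qTri_add_one h0, qTri_add_one h0, zpow_add_one₀ h0, show 2 * j = j + j by ring,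
      zpow_add₀ h0]
    field_simp
  rw [h, norm_mul]
  exact mul_le_of_le_one_right (norm_nonneg _) (norm_qTri_le_one hq _)

theorem tsum_qTri_pow_seven {q : ℂ} (h0 : q ≠ 0) (hq : ‖q‖ < 1) {k : ℕ} (hk : k ≤ 7) :
    ∑' j : ℤ, qTri q j * (q ^ 3) ^ (j * j) * ((q ^ 3) ^ j)⁻¹ * (q ^ k) ^ j =
      qPochInf₃ (q ^ k) (q ^ (7 - k)) (q ^ 7) (q ^ 7) := by
  have h := tsum_qTri_mul_zpow (pow_ne_zero 7 h0) (norm_pow_lt_one hq (by norm_num : 7 ≠ 0))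
    (pow_ne_zero k h0)
  rw [div_eq_mul_inv, ← pow_sub₀ q h0 hk] at h
  rw [qPochInf₃, ← h]
  exact tsum_congr fun j => by rw [qTri_pow_seven h0]

theorem tsum_summand₁ {q : ℂ} (h0 : q ≠ 0) (hq : ‖q‖ < 1) :
    ∑' p : ℕ × ℕ, summand₁ q p.1 p.2 =
      qPochInf₃ q (q ^ 6) (q ^ 7) (q ^ 7) / qPochInf (q ^ 3) (q ^ 3) := by
  have hp := norm_pow_lt_one hq three_ne_zero
  have hp0 : q ^ 3 ≠ 0 := pow_ne_zero 3 h0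
  rw [tsum_prod_eq_tsum_sum_antidiagonal (summable_summand₁ hq),
    tsum_congr (sum_antidiagonal_summand₁ h0 hq),
    tsum_pow_mul_tsum_qInv hp0 hp le_rfl (norm_qTri_le_one hq)]
  -- The value k = 6 comes from q^{3(j²+j)} = q^{3j²} q^{-3j} q^{6j}.
  have h := tsum_qTri_pow_seven h0 hq (k := 6) (by norm_num)
  rw [show qPochInf₃ q (q ^ 6) (q ^ 7) (q ^ 7) = qPochInf₃ (q ^ 6) (q ^ (7 - 6)) (q ^ 7) (q ^ 7) by
    rw [qPochInf₃, qPochInf₃, show 7 - 6 = 1 from rfl, pow_one]; ring, ← h]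
  congr 1
  refine tsum_congr fun j => ?_
  have hj : (q ^ 3) ^ j ≠ 0 := zpow_ne_zero _ hp0
  rw [show q ^ 6 = q ^ 3 * q ^ 3 by ring, mul_zpow, zpow_add₀ hp0]
  push_cast
  rw [one_mul]
  field_simp

theorem tsum_summand₃ {q : ℂ} (h0 : q ≠ 0) (hq : ‖q‖ < 1) :
    ∑' p : ℕ × ℕ, summand₃ q p.1 p.2 =
      qPochInf₃ (q ^ 3) (q ^ 4) (q ^ 7) (q ^ 7) / qPochInf (q ^ 3) (q ^ 3) := by
  have hp := norm_pow_lt_one hq three_ne_zero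
  have hp0 : q ^ 3 ≠ 0 := pow_ne_zero 3 h0
  rw [tsum_prod_eq_tsum_sum_antidiagonal (summable_summand₃ hq),
    tsum_congr (sum_antidiagonal_summand₃ h0 hq),
    tsum_pow_mul_tsum_qInv hp0 hp zero_le_one (norm_qTri_le_one hq)]
  have h := tsum_qTri_pow_seven h0 hq (k := 3) (by norm_num)
  rw [show q ^ 4 = q ^ (7 - 3) by norm_num, ← h]
  congr 1
  refine tsum_congr fun j => ?_
  have hj : (q ^ 3) ^ j ≠ 0 := zpow_ne_zero _ hp0
  push_cast
  rw [zero_mul, add_zero]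
  field_simp

theorem one_sub_tsum_summand₂ {q : ℂ} (h0 : q ≠ 0) (hq : ‖q‖ < 1) :
    1 - ∑' p : ℕ × ℕ, summand₂ q p.1 p.2 =
      qPochInf₃ (q ^ 2) (q ^ 5) (q ^ 7) (q ^ 7) / qPochInf (q ^ 3) (q ^ 3) := by
  have hp := norm_pow_lt_one hq three_ne_zero
  have hp0 : q ^ 3 ≠ 0 := pow_ne_zero 3 h0
  have hs := summable_sum_antidiagonal (summable_summand₂ hq)
  set f : ℕ → ℂ := fun N => (q ^ 3) ^ (N * N + 0 * N) * ∑' j : ℤ, qTri q j * q ^ (2 * j) *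
    (qInv (q ^ 3) (N - j) * qInv (q ^ 3) (N + (0 : ℕ) + j)) with hf
  have hf1 : ∀ M, f (M + 1) =
      -∑ p ∈ Finset.HasAntidiagonal.antidiagonal M, summand₂ q p.1 p.2 :=
    sum_antidiagonal_summand₂ h0 hq
  have hf0 : f 0 = 1 := by
    simp only [hf]
    rw [tsum_eq_single 0]
    · simp [qTri_zero, qInv_zero]
    · intro j hj
      rcases lt_or_gt_of_ne hj with h | h
      · rw [qInv_of_neg _ (by push_cast; omega : ((0 : ℕ) : ℤ) + (0 : ℕ) + j < 0)]; simp
      · rw [qInv_of_neg _ (by push_cast; omega : ((0 : ℕ) : ℤ) - j < 0)]; simp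
  have hfs : Summable f := by
    rw [← summable_nat_add_iff 1]
    exact hs.neg.congr fun M => (hf1 M).symm
  have hsum : 1 - ∑' p : ℕ × ℕ, summand₂ q p.1 p.2 = ∑' N, f N := by
    rw [hfs.tsum_eq_zero_add, hf0, tsum_congr hf1, tsum_neg,
      tsum_prod_eq_tsum_sum_antidiagonal (summable_summand₂ hq), sub_eq_add_neg]
  rw [hsum, hf, tsum_pow_mul_tsum_qInv hp0 hp zero_le_one (norm_qTri_mul_zpow_two_mul_le h0 hq)]
  -- Here k = 5: 3 to cancel q^{-3j}, and 2 for the extra weight q^{2j}.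
  have h := tsum_qTri_pow_seven h0 hq (k := 5) (by norm_num)
  rw [show qPochInf₃ (q ^ 2) (q ^ 5) (q ^ 7) (q ^ 7) =
    qPochInf₃ (q ^ 5) (q ^ (7 - 5)) (q ^ 7) (q ^ 7) by
    rw [qPochInf₃, qPochInf₃, show 7 - 5 = 2 from rfl]; ring, ← h]
  congr 1
  refine tsum_congr fun j => ?_
  have hj : (q ^ 3) ^ j ≠ 0 := zpow_ne_zero _ hp0
  have e2 : q ^ (2 * j) = (q ^ 2) ^ j := by rw [zpow_mul]; norm_cast
  rw [show q ^ 5 = q ^ 3 * q ^ 2 by ring, mul_zpow, e2]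
  push_cast
  rw [zero_mul, add_zero]
  field_simp

/-! ### The degenerate case q = 0 and the conclusion -/

theorem qPoch_zero_left (q : ℂ) (n : ℕ) : qPoch 0 q n = 1 := by simp [qPoch]

theorem qPochInf_zero_left (q : ℂ) : qPochInf 0 q = 1 := by simp [qPochInf]

theorem summand₁_zero {p : ℕ × ℕ} (hp : p ≠ 0) : summand₁ 0 p.1 p.2 = 0 := by
  have h : (5 * p.1 ^ 2 + 3 * p.1) / 2 + 4 * p.1 * p.2 + 2 * p.2 ^ 2 + 2 * p.2 ≠ 0 := by
    intro h
    apply hp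
    ext
    · show p.1 = 0
      omega
    · show p.2 = 0
      omega
  rw [summand₁, zero_pow h]
  simp

theorem summand₂_zero (n r : ℕ) : summand₂ 0 n r = 0 := by
  rw [summand₂, zero_pow (by omega)]
  simp

theorem summand₃_zero {p : ℕ × ℕ} (hp : p ≠ 0) : summand₃ 0 p.1 p.2 = 0 := by
  have h : (5 * p.1 ^ 2 - p.1) / 2 + 4 * p.1 * p.2 + 2 * p.2 ^ 2 ≠ 0 := by
    intro h
    apply hp
    have h1 : p.1 ≤ p.1 ^ 2 := Nat.le_self_pow two_ne_zero _
    have h2 : p.2 ≤ p.2 ^ 2 := Nat.le_self_pow two_ne_zero _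
    ext
    · show p.1 = 0
      omega
    · show p.2 = 0
      omega
  rw [summand₃, zero_pow h]
  simp

theorem mainTheorem5 (q : ℂ) (hq : ‖q‖ < 1) :
    (Summable (fun p : ℕ × ℕ => summand₁ q p.1 p.2) ∧
      ∑' p : ℕ × ℕ, summand₁ q p.1 p.2 =
        qPochInf₃ q (q ^ 6) (q ^ 7) (q ^ 7) / qPochInf (q ^ 3) (q ^ 3)) ∧
    (Summable (fun p : ℕ × ℕ => summand₂ q p.1 p.2) ∧
      1 - ∑' p : ℕ × ℕ, summand₂ q p.1 p.2 =
        qPochInf₃ (q ^ 2) (q ^ 5) (q ^ 7) (q ^ 7) / qPochInf (q ^ 3) (q ^ 3)) ∧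
    (Summable (fun p : ℕ × ℕ => summand₃ q p.1 p.2) ∧
      ∑' p : ℕ × ℕ, summand₃ q p.1 p.2 =
        qPochInf₃ (q ^ 3) (q ^ 4) (q ^ 7) (q ^ 7) / qPochInf (q ^ 3) (q ^ 3)) := by
  refine ⟨⟨summable_summand₁ hq, ?_⟩, ⟨summable_summand₂ hq, ?_⟩, ⟨summable_summand₃ hq, ?_⟩⟩
  · rcases eq_or_ne q 0 with rfl | h0
    · rw [tsum_eq_single 0 fun p hp => summand₁_zero hp]
      simp [summand₁, qPochInf₃, qPoch_zero_left, qPochInf_zero_left]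
    · exact tsum_summand₁ h0 hq
  · rcases eq_or_ne q 0 with rfl | h0
    · simp [summand₂_zero, qPochInf₃, qPochInf_zero_left]
    · exact one_sub_tsum_summand₂ h0 hq
  · rcases eq_or_ne q 0 with rfl | h0
    · rw [tsum_eq_single 0 fun p hp => summand₃_zero hp]
      simp [summand₃, qPochInf₃, qPoch_zero_left, qPochInf_zero_left]
    · exact tsum_summand₃ h0 hq
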